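/- Let $n\ge 3$ and $m\ge 2$. All Leibniz superalgebras are finite-dimensional, complex and right: a $\mathbb Z_2$-graded space $L=L_{\bar 0}\oplus L_{\bar 1}$ with an even bilinear product satisfying $[x,[y,z]]=[[x,y],z]-(-1)^{|y||z|}[[x,z],y]$ for all $x$ and all homogeneous $y,z$; isomorphisms preserve the grading. $L$ is solvable if its derived sequence ($D^0=L$, $D^{k+1}=[D^k,D^k]$) reaches $0$; a subspace $U\subseteq L$ is nilpotent if its descending central sequence ($C^0=U$, $C^{k+1}=[C^k,U]$) reaches $0$; the nilradical is the largest nilpotent graded two-sided ideal; $L^2=[L,L]$. Let $LP^{n,m}$ be the Leibniz superalgebra with even basis $x_1,\dots,x_n$, odd basis $y_1,\dots,y_m$ and only non-zero products $$[x_i,x_1]=x_{i+1}\ (2\le i\le n-1),\qquad [y_j,x_1]=y_{j+1}\ (1\le j\le m-1).$$ Let $L$ be a solvable Leibniz superalgebra with $L^2$ nilpotent and nilradical isomorphic to $LP^{n,m}$, and suppose that $L$ has the largest dimension among all Leibniz superalgebras with these properties. Then $L$ is isomorphic to the Leibniz superalgebra $SLP^{n,m}$ with basis $x_1,\dots,x_n,t_1,t_2,t_3$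 of the even part, basis $y_1,\dots,y_m$ of the odd part, and products $$\begin{array}{ll} [x_i,x_1]=x_{i+1},& 2\le i\le n-1;\\{} [y_j,x_1]=y_{j+1},& 1\le j\le m-1;\\{} [t_1,x_1]=-x_1,\quad [x_1,t_1]=x_1;&\\{} [x_i,t_1]=(i-2)x_i,& 3\le i\le n;\\{} [y_j,t_1]=(j-1)y_j,& 2\le j\le m;\\{} [x_i,t_2]=x_i,& 2\le i\le n;\\{} [y_j,t_3]=y_j,& 1\le j\le m, \end{array}$$ where the omitted products are zero. -/

import Mathlib

/-- A complex (right) Leibniz superalgebra structure on the complex vector space `L`: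
a `ℤ/2`-grading `L = part 0 ⊕ part 1` and an even bilinear product satisfying the super Leibniz
identity `[x,[y,z]] = [[x,y],z] - (-1)^(|y||z|) [[x,z],y]` for all `x` and all homogeneous
`y`, `z`. -/
structure LeibnizSuperalgebra (L : Type*) [AddCommGroup L] [Module ℂ L] where
  part : ZMod 2 → Submodule ℂ L
  isCompl : IsCompl (part 0) (part 1)
  bracket : L →ₗ[ℂ] L →ₗ[ℂ] L
  bracket_mem : ∀ (i j : ZMod 2) (x y : L), x ∈ part i → y ∈ part j →
    bracket x y ∈ part (i + j)
  leibniz : ∀ (i j : ZMod 2) (x y z : L), y ∈ part i → z ∈ part j →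
    bracket x (bracket y z) =
      bracket (bracket x y) z - (-1 : ℂ) ^ (i.val * j.val) • bracket (bracket x z) y

namespace LeibnizSuperalgebra

/-- An isomorphism of Leibniz superalgebras: a linear bijection that respects the grading and
the products. -/
structure Iso {L L' : Type*} [AddCommGroup L] [Module ℂ L] [AddCommGroup L'] [Module ℂ L']
    (A : LeibnizSuperalgebra L) (B : LeibnizSuperalgebra L') where
  toEquiv : L ≃ₗ[ℂ] L'
  map_part : ∀ i : ZMod 2, (A.part i).map toEquiv.toLinearMap = B.part i
  map_bracket : ∀ x y : L, toEquiv (A.bracket x y) = B.bracket (toEquiv x) (toEquiv y)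

section
variable {L : Type*} [AddCommGroup L] [Module ℂ L] (A : LeibnizSuperalgebra L)

/-- `[U, W]`, the linear span of all products `[u, w]` with `u ∈ U`, `w ∈ W`. -/
def prod (U W : Submodule ℂ L) : Submodule ℂ L := Submodule.map₂ A.bracket U W

/-- The square `L² = [L, L]`. -/
def square : Submodule ℂ L := A.prod ⊤ ⊤

/-- The descending central sequence of `U`: `C⁰ = U`, `Cᵏ⁺¹ = [Cᵏ, U]`. -/
def lowerCentral (U : Submodule ℂ L) : ℕ → Submodule ℂ L
  | 0 => U
  | k + 1 => A.prod (lowerCentral U k) U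

/-- The derived sequence of `U`: `D⁰ = U`, `Dᵏ⁺¹ = [Dᵏ, Dᵏ]`. -/
def derived (U : Submodule ℂ L) : ℕ → Submodule ℂ L
  | 0 => U
  | k + 1 => A.prod (derived U k) (derived U k)

/-- Nilpotency of a subspace (used for ideals and for `L²`). -/
def IsNilpotent (U : Submodule ℂ L) : Prop := ∃ k : ℕ, A.lowerCentral U k = ⊥

/-- Solvability of the whole superalgebra. -/
def IsSolvable : Prop := ∃ k : ℕ, A.derived ⊤ k = ⊥

/-- A (graded, two-sided) ideal. -/
structure IsIdeal (N : Submodule ℂ L) : Prop where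
  graded : N ≤ (N ⊓ A.part 0) ⊔ (N ⊓ A.part 1)
  bracket_left : ∀ x ∈ N, ∀ y : L, A.bracket x y ∈ N
  bracket_right : ∀ x ∈ N, ∀ y : L, A.bracket y x ∈ N

/-- `N` is the nilradical: the largest nilpotent ideal. -/
structure IsNilradical (N : Submodule ℂ L) : Prop where
  isIdeal : A.IsIdeal N
  isNilpotent : A.IsNilpotent N
  le : ∀ I : Submodule ℂ L, A.IsIdeal I → A.IsNilpotent I → I ≤ N

/-- An ideal, with the induced grading and product, as a Leibniz superalgebra. -/
def ofIdeal (N : Submodule ℂ L) (hN : A.IsIdeal N) : LeibnizSuperalgebra N where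
  part i := (A.part i).comap N.subtype
  isCompl := by
    constructor
    · rw [Submodule.disjoint_def]
      intro x h0 h1
      exact Subtype.ext (Submodule.disjoint_def.1 A.isCompl.disjoint x.1 h0 h1)
    · rw [codisjoint_iff, eq_top_iff]
      rintro ⟨x, hx⟩ -
      obtain ⟨u, hu, v, hv, rfl⟩ := Submodule.mem_sup.1 (hN.graded hx)
      exact Submodule.mem_sup.2 ⟨⟨u, hu.1⟩, hu.2, ⟨v, hv.1⟩, hv.2, rfl⟩
  bracket := LinearMap.mk₂ ℂ (fun x y => ⟨A.bracket x.1 y.1, hN.bracket_left x.1 x.2 y.1⟩)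
    (fun x x' y => Subtype.ext (by simp)) (fun c x y => Subtype.ext (by simp))
    (fun x y y' => Subtype.ext (by simp)) (fun c x y => Subtype.ext (by simp))
  bracket_mem i j x y hx hy := A.bracket_mem i j x.1 y.1 hx hy
  leibniz i j x y z hy hz := Subtype.ext (by
    simpa using A.leibniz i j x.1 y.1 z.1 hy hz)

/-- The nilradical of `A` is isomorphic to `B`. -/
def NilradicalIsoTo {L' : Type*} [AddCommGroup L'] [Module ℂ L']
    (B : LeibnizSuperalgebra L') : Prop :=
  ∃ (N : Submodule ℂ L) (hN : A.IsNilradical N), Nonempty (Iso (A.ofIdeal N hN.isIdeal) B)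

end

section
variable {ι : Type*}

/-- The bilinear product on the space with basis `ι` whose value on the basis vectors `i`, `j`
is `c i j`. -/
noncomputable def tableBracket (c : ι → ι → (ι →₀ ℂ)) :
    (ι →₀ ℂ) →ₗ[ℂ] (ι →₀ ℂ) →ₗ[ℂ] (ι →₀ ℂ) :=
  Finsupp.linearCombination ℂ (fun i => Finsupp.linearCombination ℂ (c i))

theorem tableBracket_single (c : ι → ι → (ι →₀ ℂ)) (i j : ι) (a b : ℂ) :
    tableBracket c (Finsupp.single i a) (Finsupp.single j b) = (a * b) • c i j := by
  simp [tableBracket, mul_smul]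

/-- The Leibniz superalgebra with basis `ι`, in which the basis vector `i` has degree `p i`,
given by the multiplication table `c`. -/
noncomputable def ofTable (p : ι → ZMod 2) (c : ι → ι → (ι →₀ ℂ))
    (hc : ∀ i j, c i j ∈ Finsupp.supported ℂ ℂ {k | p k = p i + p j})
    (hl : ∀ i j k, tableBracket c (Finsupp.single i 1) (c j k) =
      tableBracket c (c i j) (Finsupp.single k 1) -
        (-1 : ℂ) ^ ((p j).val * (p k).val) • tableBracket c (c i k) (Finsupp.single j 1)) :
    LeibnizSuperalgebra (ι →₀ ℂ) where
  part s := Finsupp.supported ℂ ℂ {k | p k = s}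
  isCompl := by
    constructor
    · apply Finsupp.disjoint_supported_supported
      rw [Set.disjoint_left]
      intro k h0 h1
      simp only [Set.mem_ofPred_eq] at h0 h1
      rw [h0] at h1
      exact absurd h1 (by decide)
    · apply Finsupp.codisjoint_supported_supported
      rw [codisjoint_iff, eq_top_iff]
      intro k _
      have : ∀ s : ZMod 2, s = 0 ∨ s = 1 := by decide
      exact this (p k)
  bracket := tableBracket c
  bracket_mem s t x y hx hy := by
    rw [Finsupp.supported_eq_span_single] at hx hy
    induction hx using Submodule.span_induction with
    | zero => simp
    | add u v _ _ hu hv => simpa using Submodule.add_mem _ hu hv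
    | smul a u _ hu => simpa using Submodule.smul_mem _ a hu
    | mem u hu =>
      obtain ⟨i, hi, rfl⟩ := hu
      induction hy using Submodule.span_induction with
      | zero => simp
      | add u v _ _ hu hv => simpa using Submodule.add_mem _ hu hv
      | smul a u _ hu => simpa using Submodule.smul_mem _ a hu
      | mem v hv =>
        obtain ⟨j, hj, rfl⟩ := hv
        simp only [Set.mem_ofPred_eq] at hi hj
        subst hi hj
        simpa [tableBracket_single] using hc i j
  leibniz s t x y z hy hz := by
    rw [Finsupp.supported_eq_span_single] at hy hz
    induction hy using Submodule.span_induction with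
    | zero => simp
    | add u v _ _ hu hv => simp only [map_add, LinearMap.add_apply, hu, hv, smul_add]; abel
    | smul a u _ hu => simp only [map_smul, LinearMap.smul_apply, hu, smul_sub, smul_comm a]
    | mem u hu =>
      obtain ⟨j, hj, rfl⟩ := hu
      induction hz using Submodule.span_induction with
      | zero => simp
      | add u v _ _ hu hv => simp only [map_add, LinearMap.add_apply, hu, hv, smul_add]; abel
      | smul a u _ hu => simp only [map_smul, LinearMap.smul_apply, hu, smul_sub, smul_comm a]
      | mem v hv =>
        obtain ⟨k, hk, rfl⟩ := hv
        simp only [Set.mem_ofPred_eq] at hj hk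
        subst hj hk
        induction x using Finsupp.induction_linear with
        | zero => simp
        | add u v hu hv => simp only [map_add, LinearMap.add_apply, hu, hv, smul_add]; abel
        | single i a =>
          have h := congrArg (fun w => a • w) (hl i j k)
          rw [← Finsupp.smul_single_one]
          simpa only [map_smul, LinearMap.smul_apply, smul_sub, smul_comm a,
            tableBracket_single, mul_one, one_smul] using h

end

/-! ### The filiform superalgebra `LP^{n,m}`

Indices are shifted by one: `Fin` starts at `0`, so `x ⟨i, _⟩` is the vector `x_{i+1}` and
`y ⟨j, _⟩` is `y_{j+1}`. -/

/-- Names of the basis vectors of `LP^{n,m}`. -/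
inductive LPIndex (n m : ℕ) : Type
  | x (i : Fin n)
  | y (j : Fin m)

namespace LPIndex
variable {n m : ℕ}

/-- The `x` are even, the `y` are odd. -/
def parity : LPIndex n m → ZMod 2
  | x _ => 0
  | y _ => 1

/-- The vector `x_{i+2}`, that is, the successor of `x i` (zero if there is none). -/
noncomputable def nextX (i : Fin n) : LPIndex n m →₀ ℂ :=
  if h : i.val + 1 < n then Finsupp.single (x ⟨i.val + 1, h⟩) 1 else 0

/-- The vector `y_{j+2}`, that is, the successor of `y j` (zero if there is none). -/
noncomputable def nextY (j : Fin m) : LPIndex n m →₀ ℂ :=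
  if h : j.val + 1 < m then Finsupp.single (y ⟨j.val + 1, h⟩) 1 else 0

/-- The table `[x_i, x_1] = x_{i+1}` for `2 ≤ i ≤ n-1`, `[y_j, x_1] = y_{j+1}` for
`1 ≤ j ≤ m-1`, all other products being zero. -/
noncomputable def table : LPIndex n m → LPIndex n m → (LPIndex n m →₀ ℂ)
  | x i, x k => if k.val = 0 ∧ 1 ≤ i.val then nextX i else 0
  | y j, x k => if k.val = 0 then nextY j else 0
  | _, y _ => 0

theorem table_mem (i j : LPIndex n m) :
    table i j ∈ Finsupp.supported ℂ ℂ {k | parity k = parity i + parity j} := by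
  rcases i with i | i <;> rcases j with j | j <;>
    simp only [table, nextX, nextY] <;> (try split_ifs) <;>
    first
      | exact Submodule.zero_mem _
      | (apply Finsupp.single_mem_supported; simp [parity])

theorem table_leibniz (i j k : LPIndex n m) :
    tableBracket table (Finsupp.single i 1) (table j k) =
      tableBracket table (table i j) (Finsupp.single k 1) -
        (-1 : ℂ) ^ ((parity j).val * (parity k).val) •
          tableBracket table (table i k) (Finsupp.single j 1) := by
  rcases i with i | i <;> rcases j with j | j <;> rcases k with k | k <;>
    simp only [table, nextX, nextY, parity] <;> (try split_ifs) <;>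
    simp [tableBracket_single, table, nextX, nextY] <;> grind

end LPIndex

/-- The non-Lie filiform Leibniz superalgebra `LP^{n,m}`. -/
noncomputable def LP (n m : ℕ) : LeibnizSuperalgebra (LPIndex n m →₀ ℂ) :=
  ofTable LPIndex.parity LPIndex.table LPIndex.table_mem LPIndex.table_leibniz

/-! ### The solvable superalgebra `SLP^{n,m}` -/

/-- Names of the basis vectors of `SLP^{n,m}`; `t1`, `t2`, `t3` are the vectors `t_1, t_2, t_3`,
and the indices of `x`, `y` are shifted by one as above. -/
inductive SLPIndex (n m : ℕ) : Type
  | x (i : Fin n)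
  | t1
  | t2
  | t3
  | y (j : Fin m)

namespace SLPIndex
variable {n m : ℕ}

/-- The `x` and `t` are even, the `y` are odd. -/
def parity : SLPIndex n m → ZMod 2
  | y _ => 1
  | _ => 0

/-- The vector `x_{i+2}`, that is, the successor of `x i` (zero if there is none). -/
noncomputable def nextX (i : Fin n) : SLPIndex n m →₀ ℂ :=
  if h : i.val + 1 < n then Finsupp.single (x ⟨i.val + 1, h⟩) 1 else 0

/-- The vector `y_{j+2}`, that is, the successor of `y j` (zero if there is none). -/
noncomputable def nextY (j : Fin m) : SLPIndex n m →₀ ℂ :=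
  if h : j.val + 1 < m then Finsupp.single (y ⟨j.val + 1, h⟩) 1 else 0

/-- The table (in the usual numbering from `1`)
`[x_i, x_1] = x_{i+1}` for `2 ≤ i ≤ n-1`; `[y_j, x_1] = y_{j+1}` for `1 ≤ j ≤ m-1`;
`[t_1, x_1] = -x_1`; `[x_1, t_1] = x_1`; `[x_i, t_1] = (i-2) x_i` for `3 ≤ i ≤ n`;
`[y_j, t_1] = (j-1) y_j` for `2 ≤ j ≤ m`; `[x_i, t_2] = x_i` for `2 ≤ i ≤ n`;
`[y_j, t_3] = y_j` for `1 ≤ j ≤ m`; all other products being zero. -/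
noncomputable def table : SLPIndex n m → SLPIndex n m → (SLPIndex n m →₀ ℂ)
  | x i, x k => if k.val = 0 ∧ 1 ≤ i.val then nextX i else 0
  | y j, x k => if k.val = 0 then nextY j else 0
  | t1, x k => if k.val = 0 then Finsupp.single (x k) (-1) else 0
  | x i, t1 => if i.val = 0 then Finsupp.single (x i) 1
      else Finsupp.single (x i) ((i.val : ℂ) - 1)
  | y j, t1 => Finsupp.single (y j) (j.val : ℂ)
  | x i, t2 => if 1 ≤ i.val then Finsupp.single (x i) 1 else 0
  | y j, t3 => Finsupp.single (y j) 1
  | _, _ => 0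

theorem table_mem (i j : SLPIndex n m) :
    table i j ∈ Finsupp.supported ℂ ℂ {k | parity k = parity i + parity j} := by
  rcases i with i | _ | _ | _ | i <;> rcases j with j | _ | _ | _ | j <;>
    simp only [table, nextX, nextY] <;> (try split_ifs) <;>
    first
      | exact Submodule.zero_mem _
      | (apply Finsupp.single_mem_supported; simp [parity])

theorem table_leibniz (i j k : SLPIndex n m) :
    tableBracket table (Finsupp.single i 1) (table j k) =
      tableBracket table (table i j) (Finsupp.single k 1) -
        (-1 : ℂ) ^ ((parity j).val * (parity k).val) •
          tableBracket table (table i k) (Finsupp.single j 1) := by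
  rcases i with i | _ | _ | _ | i <;> rcases j with j | _ | _ | _ | j <;>
    rcases k with k | _ | _ | _ | k <;>
    simp only [table, nextX, nextY, parity] <;> (try split_ifs) <;>
    simp [tableBracket_single, table, nextX, nextY] <;> (try split_ifs) <;> simp_all

end SLPIndex

/-- The solvable Leibniz superalgebra `SLP^{n,m}`. -/
noncomputable def SLP (n m : ℕ) : LeibnizSuperalgebra (SLPIndex n m →₀ ℂ) :=
  ofTable SLPIndex.parity SLPIndex.table SLPIndex.table_mem SLPIndex.table_leibniz

end LeibnizSuperalgebra

universe u

/-! Let `N` be the nilradical and `R_q : x ↦ [x, q]`. Since `L²` is a nilpotent graded ideal, `L² ⊆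
N`, so any graded subspace containing `N` is an ideal. Hence a homogeneous `q` for which `R_q` is
nilpotent on `N` lies in `N`, because `N + ℂq` is a nilpotent ideal. An odd `q` satisfies `R_q² = ½
R_[q,q]` with `[q, q] ∈ N`, so the odd part lies in `N`, and everything outside `N` is even up to
`N` (`IsNilradical.mem_of_right_pow_eq_zero`, `IsNilradical.odd_le`).

For even `q` the map `R_q` is a derivation. The products of `LP^{n,m}` force it to be triangular on
the chains `x_1, …, x_n` and `y_1, …, y_m`, with diagonal `α, β, β + α, β + 2α, …` and `γ, γ + α,
…`. The three weights `(α, β, γ)` depend linearly on `q`, and if they vanish then `R_q` is nilpotent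
on `N` and `q ∈ N`. Thus `dim L ≤ n + m + 3`. As `SLP^{n,m}` itself satisfies the hypotheses
(`SLP_nilradicalIsoTo`, `SLP_isNilpotent_square`), a maximal `L` has dimension at least `n + m + 3`,
and every weight vector occurs (`LPCoframe.weights_surjective`).

Choose an even `t` of weights `(1, 2, 1)`. On each chain `R_t` has the distinct nonzero eigenvalues
`1, 2, 3, …`, so it has an eigenbasis with the same multiplication table
(`LPCoframe.exists_eigenframe`). As `0` is not an eigenvalue, every even element can be corrected by
an element of `N` so that `[h, t] = 0`. Such elements annihilate each other and preserve the
eigenlines under both multiplications. The right action is then diagonal with the weights as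
entries, and the Leibniz identity determines the left action (`LPCoframe.torus_table`). Elements of
this kind with weights the three unit vectors are `t_1, t_2, t_3`. -/

namespace LeibnizSuperalgebra

/-! ### Ideals, the nilradical and nilpotent right multiplications -/

section
variable {L : Type*} [AddCommGroup L] [Module ℂ L] (A : LeibnizSuperalgebra L)

/-- Right multiplication `x ↦ [x, q]`. -/
def right (q : L) : L →ₗ[ℂ] L := A.bracket.flip q

@[simp] theorem right_apply (q x : L) : A.right q x = A.bracket x q := rfl

theorem exists_homogeneous (x : L) : ∃ u ∈ A.part 0, ∃ v ∈ A.part 1, u + v = x :=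
  Submodule.mem_sup.1 (A.isCompl.sup_eq_top ▸ Submodule.mem_top)

/-- One even factor makes the sign trivial for both homogeneous components of `z`, so no homogeneity
of `z` is needed. -/
theorem leibniz_even {y : L} (hy : y ∈ A.part 0) (x z : L) :
    A.bracket x (A.bracket y z) = A.bracket (A.bracket x y) z - A.bracket (A.bracket x z) y := by
  obtain ⟨u, hu, v, hv, rfl⟩ := A.exists_homogeneous z
  have h0 := A.leibniz 0 0 x y u hy hu
  have h1 := A.leibniz 0 1 x y v hy hv
  simp at h0 h1
  simp only [map_add, LinearMap.add_apply, h0, h1]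
  abel

/-- Right multiplication by an even element is a derivation. -/
theorem right_even {q : L} (hq : q ∈ A.part 0) (x y : L) :
    A.bracket (A.bracket x y) q =
      A.bracket x (A.bracket y q) + A.bracket (A.bracket x q) y := by
  obtain ⟨u, hu, v, hv, rfl⟩ := A.exists_homogeneous y
  have h0 := A.leibniz 0 0 x u q hu hq
  have h1 := A.leibniz 1 0 x v q hv hq
  simp at h0 h1
  simp only [map_add, LinearMap.add_apply, h0, h1]
  abel

theorem bracket_mem_square (x y : L) : A.bracket x y ∈ A.square :=
  Submodule.apply_mem_map₂ _ Submodule.mem_top Submodule.mem_top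

theorem even_add {x y : L} (i : ZMod 2) (hx : x ∈ A.part i) (hy : y ∈ A.part 0) :
    A.bracket x y ∈ A.part i := by
  simpa using A.bracket_mem i 0 x y hx hy

theorem isIdeal_of_square_le {U : Submodule ℂ L} (hU : A.square ≤ U)
    (hg : U ≤ (U ⊓ A.part 0) ⊔ (U ⊓ A.part 1)) : A.IsIdeal U :=
  ⟨hg, fun x _ y => hU (A.bracket_mem_square x y), fun x _ y => hU (A.bracket_mem_square y x)⟩

theorem isIdeal_square : A.IsIdeal A.square := by
  refine A.isIdeal_of_square_le le_rfl (Submodule.map₂_le.2 fun x _ y _ => ?_)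
  have key : ∀ i j : ZMod 2, ∀ u ∈ A.part i, ∀ v ∈ A.part j,
      A.bracket u v ∈ (A.square ⊓ A.part 0) ⊔ (A.square ⊓ A.part 1) := by
    intro i j u hu v hv
    have h := A.bracket_mem i j u v hu hv
    have h' : ∀ s : ZMod 2, s = 0 ∨ s = 1 := by decide
    rcases h' (i + j) with hs | hs <;> rw [hs] at h
    · exact Submodule.mem_sup_left ⟨A.bracket_mem_square u v, h⟩
    · exact Submodule.mem_sup_right ⟨A.bracket_mem_square u v, h⟩
  obtain ⟨u, hu, v, hv, rfl⟩ := A.exists_homogeneous x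
  obtain ⟨u', hu', v', hv', rfl⟩ := A.exists_homogeneous y
  simp only [map_add, LinearMap.add_apply]
  exact add_mem (add_mem (key _ _ _ hu _ hu') (key _ _ _ hv _ hu'))
    (add_mem (key _ _ _ hu _ hv') (key _ _ _ hv _ hv'))

variable {A}

theorem IsNilradical.square_le {N : Submodule ℂ L} (hN : A.IsNilradical N)
    (hsq : A.IsNilpotent A.square) : A.square ≤ N :=
  hN.le _ A.isIdeal_square hsq

theorem lowerCentral_succ_le {N : Submodule ℂ L} (hN : A.IsIdeal N) (k : ℕ) :
    A.lowerCentral N (k + 1) ≤ A.lowerCentral N k := by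
  induction k with
  | zero => exact Submodule.map₂_le.2 fun x hx y _ => hN.bracket_left x hx y
  | succ k ih => exact Submodule.map₂_le_map₂_left ih

theorem lowerCentral_le {N : Submodule ℂ L} (hN : A.IsIdeal N) (k : ℕ) :
    A.lowerCentral N k ≤ N :=
  (antitone_nat_of_succ_le (lowerCentral_succ_le hN)) (Nat.zero_le k)

/-- The terms of the descending central sequence of an ideal are right ideals. -/
theorem lowerCentral_bracket_mem {N : Submodule ℂ L} (hN : A.IsIdeal N) (k : ℕ) :
    ∀ x ∈ A.lowerCentral N k, ∀ i : ZMod 2, ∀ q ∈ A.part i,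
      A.bracket x q ∈ A.lowerCentral N k := by
  induction k with
  | zero => exact fun x hx _ q _ => hN.bracket_left x hx q
  | succ k ih =>
    intro x hx i q hq
    have : A.lowerCentral N (k + 1) ≤ (A.lowerCentral N (k + 1)).comap (A.right q) := by
      refine Submodule.map₂_le.2 fun a ha b hb => ?_
      -- The signed identity needs a homogeneous middle factor; the gradedness of `N` supplies it.
      have key : ∀ j : ZMod 2, ∀ c ∈ N ⊓ A.part j,
          A.bracket a c ∈ (A.lowerCentral N (k + 1)).comap (A.right q) := by
        intro j c hc
        have h := A.leibniz j i a c q hc.2 hq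
        rw [Submodule.mem_comap, right_apply, ← sub_add_cancel (A.bracket (A.bracket a c) q)
          ((-1 : ℂ) ^ (j.val * i.val) • A.bracket (A.bracket a q) c), ← h]
        exact add_mem (Submodule.apply_mem_map₂ _ ha (hN.bracket_left c hc.1 q))
          (Submodule.smul_mem _ _ (Submodule.apply_mem_map₂ _ (ih a ha i q hq) hc.1))
      obtain ⟨u, hu, v, hv, rfl⟩ := Submodule.mem_sup.1 (hN.graded hb)
      rw [map_add]
      exact add_mem (key 0 u hu) (key 1 v hv)
    exact this hx

/-- A homogeneous element acting nilpotently on the nilradical from the right belongs to it. -/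
theorem IsNilradical.mem_of_right_pow_eq_zero {N : Submodule ℂ L} (hN : A.IsNilradical N)
    (hsq : A.square ≤ N) {i : ZMod 2} {q : L} (hq : q ∈ A.part i) (p : ℕ)
    (hp : ∀ x ∈ N, (A.right q ^ p) x = 0) : q ∈ N := by
  have hi : i = 0 ∨ i = 1 := (by decide : ∀ s : ZMod 2, s = 0 ∨ s = 1) i
  set U : Submodule ℂ L := N ⊔ ℂ ∙ q with hU
  have hNU : N ≤ U := le_sup_left
  have hideal : A.IsIdeal U := by
    refine A.isIdeal_of_square_le (hsq.trans hNU) (sup_le ?_ ?_)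
    · exact hN.isIdeal.graded.trans
        (sup_le_sup (inf_le_inf_right _ hNU) (inf_le_inf_right _ hNU))
    · rw [Submodule.span_singleton_le_iff_mem]
      have hqU : q ∈ U := Submodule.mem_sup_right (Submodule.mem_span_singleton_self q)
      rcases hi with rfl | rfl
      · exact Submodule.mem_sup_left ⟨hqU, hq⟩
      · exact Submodule.mem_sup_right ⟨hqU, hq⟩
  refine hN.le U hideal ?_ (Submodule.mem_sup_right (Submodule.mem_span_singleton_self q))
  have hpow : ∀ k j, ∀ x ∈ A.lowerCentral N k, (A.right q ^ j) x ∈ A.lowerCentral N k := by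
    intro k j
    induction j with
    | zero => exact fun x hx => hx
    | succ j ih =>
      intro x hx
      rw [pow_succ', Module.End.mul_apply]
      exact lowerCentral_bracket_mem hN.isIdeal k _ (ih x hx) i q hq
  -- Modulo `C^{k+1}(N)` the products of `C^k(N)` with `N` vanish, so only the `q`-component of `U`
  -- acts, and `j` products amount to `R_q^j`. For `j = p` this is zero, and one term of the central
  -- sequence of `N` is gained.
  have step : ∀ k K, A.lowerCentral U K ≤ A.lowerCentral N k → ∀ j,
      A.lowerCentral U (K + j) ≤
        (A.lowerCentral N k).map (A.right q ^ j) ⊔ A.lowerCentral N (k + 1) := by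
    intro k K hK j
    induction j with
    | zero => exact fun x hx => Submodule.mem_sup_left ⟨x, hK hx, rfl⟩
    | succ j ih =>
      refine Submodule.map₂_le.2 fun x hx y hy => ?_
      obtain ⟨b, hb, c, hc, rfl⟩ := Submodule.mem_sup.1 hy
      obtain ⟨s, rfl⟩ := Submodule.mem_span_singleton.1 hc
      obtain ⟨_, ⟨w, hw, rfl⟩, v, hv, rfl⟩ := Submodule.mem_sup.1 (ih hx)
      simp only [map_add, LinearMap.add_apply, map_smul]
      refine add_mem (Submodule.mem_sup_right (add_mem ?_ ?_)) (Submodule.smul_mem _ _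
        (add_mem (Submodule.mem_sup_left ⟨w, hw, ?_⟩) (Submodule.mem_sup_right ?_)))
      · exact Submodule.apply_mem_map₂ _ (hpow k j w hw) hb
      · exact lowerCentral_succ_le hN.isIdeal (k + 1) (Submodule.apply_mem_map₂ _ hv hb)
      · rw [pow_succ', Module.End.mul_apply, right_apply]
      · exact lowerCentral_bracket_mem hN.isIdeal (k + 1) v hv i q hq
  have main : ∀ k, ∃ K, A.lowerCentral U K ≤ A.lowerCentral N k := by
    intro k
    induction k with
    | zero =>
      -- `U` need not lie in `N`, but `[U, U] ⊆ L²` does.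
      exact ⟨1, Submodule.map₂_le.2 fun x _ y _ => hsq (A.bracket_mem_square x y)⟩
    | succ k ih =>
      obtain ⟨K, hK⟩ := ih
      refine ⟨K + p, (step k K hK p).trans (sup_le ?_ le_rfl)⟩
      rintro _ ⟨x, hx, rfl⟩
      rw [hp x (lowerCentral_le hN.isIdeal k hx)]
      exact zero_mem _
  obtain ⟨k, hk⟩ := hN.isNilpotent
  obtain ⟨K, hK⟩ := main k
  exact ⟨K, le_bot_iff.1 (hk ▸ hK)⟩

theorem right_pow_mem_lowerCentral {N : Submodule ℂ L} {z : L} (hz : z ∈ N) (k : ℕ) :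
    ∀ x ∈ N, (A.right z ^ k) x ∈ A.lowerCentral N k := by
  induction k with
  | zero => exact fun x hx => hx
  | succ k ih =>
    intro x hx
    rw [pow_succ', Module.End.mul_apply]
    exact Submodule.apply_mem_map₂ _ (ih x hx) hz

/-- If `L²` lies in the nilradical then so does the odd part. -/
theorem IsNilradical.odd_le {N : Submodule ℂ L} (hN : A.IsNilradical N)
    (hsq : A.square ≤ N) : A.part 1 ≤ N := by
  intro q hq
  obtain ⟨k, hk⟩ := hN.isNilpotent
  -- For odd `q` the sign turns the difference in the Leibniz identity into a sum: `[x, [q, q]] = 2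
  -- [[x, q], q]`.
  have h2 : A.right q ^ 2 = (2⁻¹ : ℂ) • A.right (A.bracket q q) := by
    ext x
    have h := A.leibniz 1 1 x q q hq hq
    have h1 : ((1 : ZMod 2).val * (1 : ZMod 2).val) = 1 := by decide
    rw [h1] at h
    simp [pow_two, h, ← two_smul ℂ]
  refine hN.mem_of_right_pow_eq_zero hsq hq (2 * k) fun x hx => ?_
  have h0 := right_pow_mem_lowerCentral (A := A) (hsq (A.bracket_mem_square q q)) k x hx
  rw [hk, Submodule.mem_bot] at h0
  rw [pow_mul, h2, smul_pow, LinearMap.smul_apply, h0, smul_zero]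

end

end LeibnizSuperalgebra

/-! ### Triangular operators on flags of eventually vanishing sequences -/

section Flag
variable {L : Type*} [AddCommGroup L] [Module ℂ L]

/-- The span of the tail `Z k, Z (k + 1), …` of a sequence of vectors. -/
def flag (Z : ℕ → L) (k : ℕ) : Submodule ℂ L := Submodule.span ℂ (Z '' {i | k ≤ i})

theorem mem_flag (Z : ℕ → L) {k i : ℕ} (h : k ≤ i) : Z i ∈ flag Z k :=
  Submodule.subset_span ⟨i, h, rfl⟩

theorem flag_le {Z : ℕ → L} {k : ℕ} {S : Submodule ℂ L} (h : ∀ i, k ≤ i → Z i ∈ S) :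
    flag Z k ≤ S := by
  rw [flag, Submodule.span_le]
  rintro _ ⟨i, hi, rfl⟩
  exact h i hi

theorem flag_anti (Z : ℕ → L) {k l : ℕ} (h : k ≤ l) : flag Z l ≤ flag Z k :=
  flag_le fun _ hi => mem_flag Z (h.trans hi)

theorem flag_eq_bot {Z : ℕ → L} {K k : ℕ} (hZ : ∀ i, K ≤ i → Z i = 0) (hk : K ≤ k) :
    flag Z k = ⊥ :=
  le_bot_iff.1 (flag_le fun i hi => by simp [hZ i (hk.trans hi)])

theorem flag_decomp {Z : ℕ → L} {k : ℕ} {v : L} (hv : v ∈ flag Z k) :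
    ∃ c : ℂ, v - c • Z k ∈ flag Z (k + 1) := by
  have h : flag Z k ≤ (ℂ ∙ Z k) ⊔ flag Z (k + 1) := flag_le fun i hi => by
    rcases hi.eq_or_lt with rfl | hi
    · exact Submodule.mem_sup_left (Submodule.mem_span_singleton_self _)
    · exact Submodule.mem_sup_right (mem_flag Z hi)
  obtain ⟨a, ha, b, hb, rfl⟩ := Submodule.mem_sup.1 (h hv)
  obtain ⟨c, rfl⟩ := Submodule.mem_span_singleton.1 ha
  exact ⟨c, by simpa using hb⟩

/-- A vector congruent to `Z k` modulo the next term of the flag, for all `k`, spans it. -/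
theorem flag_le_flag {Z W : ℕ → L} {K : ℕ} (hZ : ∀ i, K ≤ i → Z i = 0)
    (hW : ∀ k, W k - Z k ∈ flag Z (k + 1)) (k : ℕ) : flag Z k ≤ flag W k := by
  have h : ∀ d k, K ≤ k + d → flag Z k ≤ flag W k := by
    intro d
    induction d with
    | zero => exact fun k hk => by rw [flag_eq_bot hZ (k := k) hk]; exact bot_le
    | succ d ih =>
      intro k hk v hv
      have hle := (ih (k + 1) (by omega)).trans (flag_anti W k.le_succ)
      obtain ⟨c, hc⟩ := flag_decomp hv
      have hZk := sub_mem (mem_flag W (le_refl k)) (hle (hW k))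
      rw [sub_sub_cancel] at hZk
      rw [← sub_add_cancel v (c • Z k)]
      exact add_mem (hle hc) (Submodule.smul_mem _ c hZk)
  exact h K k (by omega)

/-- `T` is triangular with diagonal entries `d k` on the vectors `Z k`, `k ≥ k₀`. -/
def Triangular (T : L →ₗ[ℂ] L) (Z : ℕ → L) (d : ℕ → ℂ) (k₀ : ℕ) : Prop :=
  ∀ k, k₀ ≤ k → T (Z k) - d k • Z k ∈ flag Z (k + 1)

namespace Triangular
variable {T : L →ₗ[ℂ] L} {Z : ℕ → L} {d : ℕ → ℂ} {k₀ : ℕ}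

theorem mono (h : Triangular T Z d k₀) {k : ℕ} (hk : k₀ ≤ k) : Triangular T Z d k :=
  fun l hl => h l (hk.trans hl)

theorem map_mem (h : Triangular T Z d k₀) {k : ℕ} (hk : k₀ ≤ k) {v : L}
    (hv : v ∈ flag Z k) : T v ∈ flag Z k := by
  have : flag Z k ≤ (flag Z k).comap T := flag_le fun i hi => by
    rw [Submodule.mem_comap, ← sub_add_cancel (T (Z i)) (d i • Z i)]
    exact add_mem (flag_anti Z (by omega) (h i (hk.trans hi)))
      (Submodule.smul_mem _ _ (mem_flag Z hi))
  exact this hv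

/-- The diagonal entry does not change when `Z k` is replaced by a vector congruent to it modulo the
next term of the flag. -/
theorem sub_smul_mem (h : Triangular T Z d k₀) (W : L) {k : ℕ} (hk : k₀ ≤ k)
    (hW : W - Z k ∈ flag Z (k + 1)) : T W - d k • W ∈ flag Z (k + 1) := by
  have e : T W - d k • W = (T (Z k) - d k • Z k) + (T (W - Z k) - d k • (W - Z k)) := by
    simp only [map_sub, smul_sub]; abel
  rw [e]
  exact add_mem (h k hk) (sub_mem (h.map_mem (by omega) hW) (Submodule.smul_mem _ _ hW))

/-- `T - s` is surjective on a term of the flag if `s` is not a diagonal entry there. -/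
theorem exists_sub_smul_eq (h : Triangular T Z d k₀) {K : ℕ} (hZ : ∀ i, K ≤ i → Z i = 0)
    {s : ℂ} (hs : ∀ k, k₀ ≤ k → d k ≠ s) {w : L} (hw : w ∈ flag Z k₀) :
    ∃ v ∈ flag Z k₀, T v - s • v = w := by
  have key : ∀ e k, k₀ ≤ k → K ≤ k + e → ∀ w ∈ flag Z k, ∃ v ∈ flag Z k, T v - s • v = w := by
    intro e
    induction e with
    | zero =>
      intro k _ hk w hw
      rw [flag_eq_bot hZ (k := k) hk, Submodule.mem_bot] at hw
      exact ⟨0, zero_mem _, by simp [hw]⟩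
    | succ e ih =>
      intro k hk hK w hw
      obtain ⟨c, hc⟩ := flag_decomp hw
      have hne : d k - s ≠ 0 := sub_ne_zero.2 (hs k hk)
      -- The coefficient of `Z k` is solved by division by `d k - s`; the error this causes lies one
      -- step down the flag and is absorbed by induction.
      obtain ⟨v, hv, hv'⟩ := ih (k + 1) (by omega) (by omega)
        (w - c • Z k - (c / (d k - s)) • (T (Z k) - d k • Z k))
        (sub_mem hc (Submodule.smul_mem _ _ (h k hk)))
      refine ⟨(c / (d k - s)) • Z k + v, add_mem (Submodule.smul_mem _ _ (mem_flag Z le_rfl))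
        (flag_anti Z k.le_succ hv), ?_⟩
      have e1 : T ((c / (d k - s)) • Z k + v) - s • ((c / (d k - s)) • Z k + v)
        = (c / (d k - s)) • (T (Z k) - d k • Z k) + ((c / (d k - s)) * (d k - s)) • Z k
          + (T v - s • v) := by
        simp only [map_add, map_smul]; module
      rw [e1, hv', div_mul_cancel₀ _ hne]
      abel
  exact key K k₀ le_rfl (by omega) w hw

/-- On the finite-dimensional space `flag Z k₀` the operator `T - s` is surjective, hence injective.
-/
theorem eq_zero [FiniteDimensional ℂ L] (h : Triangular T Z d k₀) {K : ℕ}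
    (hZ : ∀ i, K ≤ i → Z i = 0) {s : ℂ} (hs : ∀ k, k₀ ≤ k → d k ≠ s) {v : L}
    (hv : v ∈ flag Z k₀) (h0 : T v = s • v) : v = 0 := by
  have hmap : ∀ x ∈ flag Z k₀, (T - s • (LinearMap.id : L →ₗ[ℂ] L)) x ∈ flag Z k₀ := fun x hx =>
    sub_mem (h.map_mem le_rfl hx) (Submodule.smul_mem _ _ hx)
  have hsurj : Function.Surjective ((T - s • (LinearMap.id : L →ₗ[ℂ] L)).restrict hmap) := by
    rintro ⟨w, hw⟩
    obtain ⟨v, hv, e⟩ := h.exists_sub_smul_eq hZ hs hw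
    exact ⟨⟨v, hv⟩, Subtype.ext e⟩
  have := LinearMap.injective_iff_surjective.2 hsurj
    (a₁ := ⟨v, hv⟩) (a₂ := 0) (Subtype.ext (by simp [LinearMap.restrict_apply, h0]))
  exact congrArg Subtype.val this

/-- Existence of eigenvectors. -/
theorem exists_eigenvector (h : Triangular T Z d k₀) {K : ℕ} (hZ : ∀ i, K ≤ i → Z i = 0)
    (hd : ∀ k, k₀ < k → d k ≠ d k₀) :
    ∃ v, v - Z k₀ ∈ flag Z (k₀ + 1) ∧ T v = d k₀ • v := by
  -- `(T - d k₀) Z k₀` lies in the next term of the flag, where `T - d k₀` is surjective;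
  -- subtracting a preimage from `Z k₀` leaves an eigenvector.
  obtain ⟨v, hv, e⟩ := (h.mono k₀.le_succ).exists_sub_smul_eq hZ (fun k hk => hd k hk)
    (h k₀ le_rfl)
  refine ⟨Z k₀ - v, by simpa using hv, ?_⟩
  rw [map_sub, ← sub_eq_zero]
  rw [← sub_eq_zero] at e
  rw [← neg_eq_zero, ← e, smul_sub]
  abel

/-- With zero diagonal, each application of `T` moves one step down the flag. -/
theorem pow_eq_zero (h : Triangular T Z 0 k₀) {K : ℕ} (hZ : ∀ i, K ≤ i → Z i = 0)
    {v : L} (hv : v ∈ flag Z k₀) : (T ^ K) v = 0 := by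
  have key : ∀ e, (T ^ e) v ∈ flag Z (k₀ + e) := by
    intro e
    induction e with
    | zero => exact hv
    | succ e ih =>
      rw [pow_succ', Module.End.mul_apply]
      have : flag Z (k₀ + e) ≤ (flag Z (k₀ + e + 1)).comap T := flag_le fun i hi => by
        have := h i (by omega)
        rw [Pi.zero_apply, zero_smul, sub_zero] at this
        exact flag_anti Z (by omega) this
      exact this ih
  simpa [flag_eq_bot hZ (show K ≤ k₀ + K by omega)] using key K

end Triangular

end Flag

namespace LeibnizSuperalgebra

/-! ### The action of even elements on the nilradical -/

section Frame
variable {L : Type*} [AddCommGroup L] [Module ℂ L]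

/-- Vectors multiplied according to the table of `LP^{n,m}`; the sequences are continued by
zero. -/
structure LPFrame (A : LeibnizSuperalgebra L) (n m : ℕ) (X Y : ℕ → L) : Prop where
  X_even : ∀ k, X k ∈ A.part 0
  Y_odd : ∀ k, Y k ∈ A.part 1
  X_zero : ∀ k, n ≤ k → X k = 0
  Y_zero : ∀ k, m ≤ k → Y k = 0
  X_X_succ : ∀ k l, A.bracket (X k) (X (l + 1)) = 0
  X_zero_zero : A.bracket (X 0) (X 0) = 0
  X_succ_zero : ∀ k, A.bracket (X (k + 1)) (X 0) = X (k + 2)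
  Y_X_succ : ∀ k l, A.bracket (Y k) (X (l + 1)) = 0
  Y_X_zero : ∀ k, A.bracket (Y k) (X 0) = Y (k + 1)
  X_Y : ∀ k l, A.bracket (X k) (Y l) = 0
  Y_Y : ∀ k l, A.bracket (Y k) (Y l) = 0

/-- The frame spans an ideal `N` containing the square, and comes with coordinate functions. -/
structure LPCoframe (A : LeibnizSuperalgebra L) (n m : ℕ) (N : Submodule ℂ L) (X Y : ℕ → L)
    (cX cY : ℕ → L →ₗ[ℂ] ℂ) : Prop extends LPFrame A n m X Y where
  square_le : A.square ≤ N
  even_le : N ⊓ A.part 0 ≤ flag X 0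
  odd_le : N ⊓ A.part 1 ≤ flag Y 0
  cX_X : ∀ k l, k < n → cX k (X l) = if k = l then 1 else 0
  cY_Y : ∀ k l, k < m → cY k (Y l) = if k = l then 1 else 0

/-- The weight of `X k` for a derivation with weights `α`, `β` on `X 0`, `X 1`. -/
def xWeight (α β : ℂ) : ℕ → ℂ
  | 0 => α
  | k + 1 => β + k * α

/-- The weight of `Y k` for a derivation with weights `α`, `γ` on `X 0`, `Y 0`. -/
def yWeight (α γ : ℂ) (k : ℕ) : ℂ := γ + k * α

variable {A : LeibnizSuperalgebra L} {n m : ℕ} {N : Submodule ℂ L} {X Y : ℕ → L}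
  {cX cY : ℕ → L →ₗ[ℂ] ℂ}

namespace LPFrame

theorem flag_X_even (F : LPFrame A n m X Y) (k : ℕ) : flag X k ≤ A.part 0 :=
  flag_le fun i _ => F.X_even i

theorem flag_Y_odd (F : LPFrame A n m X Y) (k : ℕ) : flag Y k ≤ A.part 1 :=
  flag_le fun i _ => F.Y_odd i

theorem bracket_X_X (F : LPFrame A n m X Y) {u v : L} (hu : u ∈ flag X 0)
    (hv : v ∈ flag X 1) : A.bracket u v = 0 := by
  have h1 : flag X 0 ≤ LinearMap.ker (A.bracket.flip v) := flag_le fun i _ => by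
    have h2 : flag X 1 ≤ LinearMap.ker (A.bracket (X i)) := flag_le fun j hj => by
      obtain ⟨l, rfl⟩ := Nat.exists_eq_add_of_le' hj
      exact F.X_X_succ i l
    exact h2 hv
  exact h1 hu

theorem bracket_Y_X (F : LPFrame A n m X Y) {u v : L} (hu : u ∈ flag Y 0)
    (hv : v ∈ flag X 1) : A.bracket u v = 0 := by
  have h1 : flag Y 0 ≤ LinearMap.ker (A.bracket.flip v) := flag_le fun i _ => by
    have h2 : flag X 1 ≤ LinearMap.ker (A.bracket (Y i)) := flag_le fun j hj => by
      obtain ⟨l, rfl⟩ := Nat.exists_eq_add_of_le' hj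
      exact F.Y_X_succ i l
    exact h2 hv
  exact h1 hu

theorem bracket_X_Y (F : LPFrame A n m X Y) {u v : L} (hu : u ∈ flag X 0)
    (hv : v ∈ flag Y 0) : A.bracket u v = 0 := by
  have h1 : flag X 0 ≤ LinearMap.ker (A.bracket.flip v) := flag_le fun i _ => by
    have h2 : flag Y 0 ≤ LinearMap.ker (A.bracket (X i)) := flag_le fun j _ => F.X_Y i j
    exact h2 hv
  exact h1 hu

theorem bracket_Y_Y (F : LPFrame A n m X Y) {u v : L} (hu : u ∈ flag Y 0)
    (hv : v ∈ flag Y 0) : A.bracket u v = 0 := by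
  have h1 : flag Y 0 ≤ LinearMap.ker (A.bracket.flip v) := flag_le fun i _ => by
    have h2 : flag Y 0 ≤ LinearMap.ker (A.bracket (Y i)) := flag_le fun j _ => F.Y_Y i j
    exact h2 hv
  exact h1 hu

/-- On `N`, right multiplication by an element only depends on it modulo `flag X 1`. -/
theorem bracket_X_congr (F : LPFrame A n m X Y) {u v w : L} (hu : u ∈ flag X 0)
    (hv : v - w ∈ flag X 1) : A.bracket u v = A.bracket u w := by
  rw [← sub_eq_zero, ← map_sub]; exact F.bracket_X_X hu hv

theorem bracket_Y_congr (F : LPFrame A n m X Y) {u v w : L} (hu : u ∈ flag Y 0)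
    (hv : v - w ∈ flag X 1) : A.bracket u v = A.bracket u w := by
  rw [← sub_eq_zero, ← map_sub]; exact F.bracket_Y_X hu hv

theorem bracket_X_zero_mem (F : LPFrame A n m X Y) {k : ℕ} {u : L} (hu : u ∈ flag X k) :
    A.bracket u (X 0) ∈ flag X (k + 1) := by
  have h1 : flag X k ≤ (flag X (k + 1)).comap (A.bracket.flip (X 0)) := flag_le fun i hi => by
    rw [Submodule.mem_comap, LinearMap.flip_apply]
    rcases i with _ | i
    · rw [F.X_zero_zero]; exact zero_mem _
    · rw [F.X_succ_zero]; exact mem_flag X (by omega)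
  exact h1 hu

theorem bracket_Y_zero_mem (F : LPFrame A n m X Y) {k : ℕ} {u : L} (hu : u ∈ flag Y k) :
    A.bracket u (X 0) ∈ flag Y (k + 1) := by
  have h1 : flag Y k ≤ (flag Y (k + 1)).comap (A.bracket.flip (X 0)) := flag_le fun i hi => by
    rw [Submodule.mem_comap, LinearMap.flip_apply, F.Y_X_zero]
    exact mem_flag Y (by omega)
  exact h1 hu

end LPFrame

namespace LPCoframe

theorem cX_flag (F : LPCoframe A n m N X Y cX cY) {k : ℕ} (hk : k < n) {v : L}
    (hv : v ∈ flag X (k + 1)) : cX k v = 0 := by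
  have h : flag X (k + 1) ≤ LinearMap.ker (cX k) := flag_le fun i hi => by
    rw [LinearMap.mem_ker, F.cX_X k i hk, if_neg (by omega)]
  exact h hv

theorem cY_flag (F : LPCoframe A n m N X Y cX cY) {k : ℕ} (hk : k < m) {v : L}
    (hv : v ∈ flag Y (k + 1)) : cY k v = 0 := by
  have h : flag Y (k + 1) ≤ LinearMap.ker (cY k) := flag_le fun i hi => by
    rw [LinearMap.mem_ker, F.cY_Y k i hk, if_neg (by omega)]
  exact h hv

theorem sub_cX_smul_mem (F : LPCoframe A n m N X Y cX cY) {k : ℕ} (hk : k < n) {v : L}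
    (hv : v ∈ flag X k) : v - cX k v • X k ∈ flag X (k + 1) := by
  obtain ⟨c, hc⟩ := flag_decomp hv
  have h := F.cX_flag hk hc
  rw [map_sub, map_smul, F.cX_X k k hk, if_pos rfl, smul_eq_mul, mul_one, sub_eq_zero] at h
  rwa [h]

theorem sub_cY_smul_mem (F : LPCoframe A n m N X Y cX cY) {k : ℕ} (hk : k < m) {v : L}
    (hv : v ∈ flag Y k) : v - cY k v • Y k ∈ flag Y (k + 1) := by
  obtain ⟨c, hc⟩ := flag_decomp hv
  have h := F.cY_flag hk hc
  rw [map_sub, map_smul, F.cY_Y k k hk, if_pos rfl, smul_eq_mul, mul_one, sub_eq_zero] at h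
  rwa [h]

theorem X_ne_zero (F : LPCoframe A n m N X Y cX cY) {k : ℕ} (hk : k < n) {v : L}
    (hv : v - X k ∈ flag X (k + 1)) : v ≠ 0 := by
  rintro rfl
  have h := F.cX_flag hk hv
  rw [map_sub, map_zero, F.cX_X k k hk, if_pos rfl] at h
  norm_num at h

theorem Y_ne_zero (F : LPCoframe A n m N X Y cX cY) {k : ℕ} (hk : k < m) {v : L}
    (hv : v - Y k ∈ flag Y (k + 1)) : v ≠ 0 := by
  rintro rfl
  have h := F.cY_flag hk hv
  rw [map_sub, map_zero, F.cY_Y k k hk, if_pos rfl] at h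
  norm_num at h

theorem bracket_even_even (F : LPCoframe A n m N X Y cX cY) {u v : L} (hu : u ∈ A.part 0)
    (hv : v ∈ A.part 0) : A.bracket u v ∈ flag X 0 :=
  F.even_le ⟨F.square_le (A.bracket_mem_square u v), A.even_add 0 hu hv⟩

theorem bracket_odd_even (F : LPCoframe A n m N X Y cX cY) {u v : L} (hu : u ∈ A.part 1)
    (hv : v ∈ A.part 0) : A.bracket u v ∈ flag Y 0 :=
  F.odd_le ⟨F.square_le (A.bracket_mem_square u v), A.even_add 1 hu hv⟩

theorem bracket_even_odd (F : LPCoframe A n m N X Y cX cY) {u v : L} (hu : u ∈ A.part 0)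
    (hv : v ∈ A.part 1) : A.bracket u v ∈ flag Y 0 :=
  F.odd_le ⟨F.square_le (A.bracket_mem_square u v), by simpa using A.bracket_mem 0 1 u v hu hv⟩

/-- An even element acts on the even part of `N` by triangular matrices. -/
theorem triangular_X (F : LPCoframe A n m N X Y cX cY) (hn : 3 ≤ n) {q : L}
    (hq : q ∈ A.part 0) : Triangular (A.right q) X
      (xWeight (cX 0 (A.bracket (X 0) q)) (cX 1 (A.bracket (X 1) q))) 0 := by
  set α := cX 0 (A.bracket (X 0) q)
  have h0 : A.bracket (X 0) q - α • X 0 ∈ flag X 1 :=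
    F.sub_cX_smul_mem (by omega) (F.bracket_even_even (F.X_even 0) hq)
  -- The derivation `R_q` applied to `[X 1, X 1] = 0` leaves `[X 1, [X 1, q]] = 0`, which is `X 2`
  -- times the coefficient of `X 0` in `[X 1, q]`. Since `n ≥ 3`, `X 2 ≠ 0` and this coefficient
  -- vanishes.
  have h1 : A.bracket (X 1) q ∈ flag X 1 := by
    have h := F.bracket_even_even (F.X_even 1) hq
    have hc := F.sub_cX_smul_mem (by omega) h
    have e := A.right_even hq (X 1) (X 1)
    rw [F.X_X_succ 1 0, map_zero, LinearMap.zero_apply, F.bracket_X_X h (mem_flag X le_rfl),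
      add_zero, F.bracket_X_congr (mem_flag X (Nat.zero_le 1)) hc, map_smul,
      F.X_succ_zero 0] at e
    have e' := (smul_eq_zero.1 e.symm).resolve_right
      (F.X_ne_zero (k := 2) (by omega) (by simp))
    rwa [e', zero_smul, sub_zero] at hc
  intro k _
  induction k with
  | zero => exact h0
  | succ k ih =>
    rcases k with _ | k
    · have := F.sub_cX_smul_mem (by omega) h1
      simpa [xWeight] using this
    · have ih := ih (Nat.zero_le _)
      rw [right_apply] at ih ⊢
      have e := A.right_even hq (X (k + 1)) (X 0)
      rw [F.bracket_X_congr (mem_flag X (Nat.zero_le _)) h0, map_smul, F.X_succ_zero k] at e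
      have h2 := F.bracket_X_zero_mem ih
      rw [map_sub, map_smul, LinearMap.sub_apply, LinearMap.smul_apply, F.X_succ_zero k] at h2
      rw [e]
      convert h2 using 1
      simp only [xWeight]
      push_cast
      module

theorem triangular_Y (F : LPCoframe A n m N X Y cX cY) (hn : 3 ≤ n) (hm : 2 ≤ m) {q : L}
    (hq : q ∈ A.part 0) : Triangular (A.right q) Y
      (yWeight (cX 0 (A.bracket (X 0) q)) (cY 0 (A.bracket (Y 0) q))) 0 := by
  set α := cX 0 (A.bracket (X 0) q)
  have h0 : A.bracket (X 0) q - α • X 0 ∈ flag X 1 :=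
    F.sub_cX_smul_mem (by omega) (F.bracket_even_even (F.X_even 0) hq)
  intro k _
  induction k with
  | zero =>
    have := F.sub_cY_smul_mem (by omega) (F.bracket_odd_even (F.Y_odd 0) hq)
    simpa [yWeight] using this
  | succ k ih =>
    have ih := ih (Nat.zero_le _)
    rw [right_apply] at ih ⊢
    have e := A.right_even hq (Y k) (X 0)
    rw [F.bracket_Y_congr (mem_flag Y (Nat.zero_le _)) h0, map_smul, F.Y_X_zero k] at e
    have h2 := F.bracket_Y_zero_mem ih
    rw [map_sub, map_smul, LinearMap.sub_apply, LinearMap.smul_apply, F.Y_X_zero k] at h2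
    rw [e]
    convert h2 using 1
    simp only [yWeight]
    push_cast
    module

/-- Eigenvalues of a derivation add under multiplication. -/
theorem bracket_bracket_eigen {t u v : L} {a b : ℂ} (ht : t ∈ A.part 0)
    (hu : A.bracket u t = a • u) (hv : A.bracket v t = b • v) :
    A.bracket (A.bracket u v) t = (a + b) • A.bracket u v := by
  rw [A.right_even ht, hu, hv, map_smul, map_smul, LinearMap.smul_apply]
  module

/-- The diagonalisation of the action of a suitable even element on `N`. -/
theorem exists_eigenframe [FiniteDimensional ℂ L] (F : LPCoframe A n m N X Y cX cY)
    {t : L} (ht : t ∈ A.part 0)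
    (hX : Triangular (A.right t) X (fun k => (k : ℂ) + 1) 0)
    (hY : Triangular (A.right t) Y (fun k => (k : ℂ) + 1) 0) :
    ∃ e g : ℕ → L, LPFrame A n m e g ∧ (∀ k, e k - X k ∈ flag X (k + 1)) ∧
      (∀ k, g k - Y k ∈ flag Y (k + 1)) ∧ (∀ k, A.bracket (e k) t = ((k : ℂ) + 1) • e k) ∧
      (∀ k, A.bracket (g k) t = ((k : ℂ) + 1) • g k) := by
  have hne : ∀ k l : ℕ, l < k → (k : ℂ) + 1 ≠ l + 1 := fun k l h => by
    norm_cast; omega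
  obtain ⟨e₀, he₀, he₀t⟩ := hX.exists_eigenvector F.X_zero (hne · 0)
  obtain ⟨e₁, he₁, he₁t⟩ := (hX.mono (Nat.zero_le 1)).exists_eigenvector F.X_zero (hne · 1)
  obtain ⟨g₀, hg₀, hg₀t⟩ := hY.exists_eigenvector F.Y_zero (hne · 0)
  rw [right_apply] at he₀t he₁t hg₀t
  have hmem : ∀ {Z : ℕ → L} {k : ℕ} {v : L}, v - Z k ∈ flag Z (k + 1) → v ∈ flag Z k := by
    intro Z k v hv
    rw [← sub_add_cancel v (Z k)]
    exact add_mem (flag_anti Z k.le_succ hv) (mem_flag Z le_rfl)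
  have stepX : ∀ k v, v - X (k + 1) ∈ flag X (k + 2) →
      A.bracket v e₀ - X (k + 2) ∈ flag X (k + 3) := by
    intro k v hv
    have := F.bracket_X_zero_mem hv
    rwa [map_sub, LinearMap.sub_apply, F.X_succ_zero, ← F.bracket_X_congr
      (flag_anti X (Nat.zero_le _) (hmem hv)) he₀] at this
  have stepY : ∀ k v, v - Y k ∈ flag Y (k + 1) →
      A.bracket v e₀ - Y (k + 1) ∈ flag Y (k + 2) := by
    intro k v hv
    have := F.bracket_Y_zero_mem hv
    rwa [map_sub, LinearMap.sub_apply, F.Y_X_zero, ← F.bracket_Y_congr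
      (flag_anti Y (Nat.zero_le _) (hmem hv)) he₀] at this
  -- Only `e₀`, `e₁`, `g₀` are chosen as eigenvectors. The rest are generated by `R_{e₀}`, so the
  -- chain relations hold by construction and the eigenvalues follow by addition.
  let e : ℕ → L := fun k => Nat.casesOn k e₀ fun k => (A.right e₀ ^ k) e₁
  let g : ℕ → L := fun k => (A.right e₀ ^ k) g₀
  have e_succ : ∀ k, e (k + 2) = A.bracket (e (k + 1)) e₀ := fun k => by
    change (A.right e₀ ^ (k + 1)) e₁ = A.right e₀ ((A.right e₀ ^ k) e₁)
    rw [pow_succ', Module.End.mul_apply]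
  have g_succ : ∀ k, g (k + 1) = A.bracket (g k) e₀ := fun k => by
    change (A.right e₀ ^ (k + 1)) g₀ = A.right e₀ ((A.right e₀ ^ k) g₀)
    rw [pow_succ', Module.End.mul_apply]
  have eX : ∀ k, e (k + 1) - X (k + 1) ∈ flag X (k + 2) := by
    intro k
    induction k with
    | zero => exact he₁
    | succ k ih => rw [e_succ]; exact stepX k _ ih
  have eX' : ∀ k, e k - X k ∈ flag X (k + 1)
    | 0 => he₀
    | k + 1 => eX k
  have gY : ∀ k, g k - Y k ∈ flag Y (k + 1) := by
    intro k
    induction k with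
    | zero => exact hg₀
    | succ k ih => rw [g_succ]; exact stepY k _ ih
  have et : ∀ k, A.bracket (e (k + 1)) t = (((k + 1 : ℕ) : ℂ) + 1) • e (k + 1) := by
    intro k
    induction k with
    | zero => exact he₁t
    | succ k ih =>
      rw [e_succ, bracket_bracket_eigen ht ih he₀t]
      push_cast
      module
  have gt : ∀ k, A.bracket (g k) t = ((k : ℂ) + 1) • g k := by
    intro k
    induction k with
    | zero => exact hg₀t
    | succ k ih =>
      rw [g_succ, bracket_bracket_eigen ht ih he₀t]
      push_cast
      module
  have e_mem : ∀ k, e k ∈ flag X 0 := fun k => flag_anti X (Nat.zero_le k) (hmem (eX' k))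
  have e_mem' : ∀ k, e (k + 1) ∈ flag X 1 := fun k =>
    flag_anti X (Nat.succ_le_succ (Nat.zero_le k)) (hmem (eX k))
  have g_mem : ∀ k, g k ∈ flag Y 0 := fun k => flag_anti Y (Nat.zero_le k) (hmem (gY k))
  -- This product has eigenvalue `2` but lies in `flag X 2`, where the diagonal entries start at
  -- `3`.
  have e00 : A.bracket e₀ e₀ = 0 := by
    refine (hX.mono (Nat.zero_le 2)).eq_zero F.X_zero (s := (1 : ℕ) + 1)
      (fun k hk => hne k 1 hk) ?_ ?_
    · have h := F.bracket_X_zero_mem he₀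
      rwa [map_sub, LinearMap.sub_apply, F.X_zero_zero, sub_zero,
        ← F.bracket_X_congr (u := e₀) (e_mem 0) he₀] at h
    · rw [right_apply, bracket_bracket_eigen ht he₀t he₀t]
      norm_num
  refine ⟨e, g, ⟨fun k => F.flag_X_even 0 (e_mem k), fun k => F.flag_Y_odd 0 (g_mem k), ?_, ?_,
    fun k l => F.bracket_X_X (e_mem k) (e_mem' l), e00, fun k => (e_succ k).symm,
    fun k l => F.bracket_Y_X (g_mem k) (e_mem' l), fun k => (g_succ k).symm,
    fun k l => F.bracket_X_Y (e_mem k) (g_mem l), fun k l => F.bracket_Y_Y (g_mem k) (g_mem l)⟩,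
    eX', gY, ?_, gt⟩
  · intro k hk
    have := hmem (eX' k)
    rwa [flag_eq_bot F.X_zero hk, Submodule.mem_bot] at this
  · intro k hk
    have := hmem (gY k)
    rwa [flag_eq_bot F.Y_zero hk, Submodule.mem_bot] at this
  · rintro (_ | k)
    · exact he₀t
    · exact et k

end LPCoframe

end Frame

end LeibnizSuperalgebra

namespace LeibnizSuperalgebra

/-! ### Isomorphisms given by multiplication tables -/

section
variable {L L' : Type*} [AddCommGroup L] [Module ℂ L] [AddCommGroup L'] [Module ℂ L']

/-- A multiplicative linear equivalence which maps parts into parts is an isomorphism. -/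
def Iso.ofLE {A : LeibnizSuperalgebra L} {B : LeibnizSuperalgebra L'} (e : L ≃ₗ[ℂ] L')
    (hp : ∀ i, ∀ x ∈ A.part i, e x ∈ B.part i)
    (hb : ∀ x y, e (A.bracket x y) = B.bracket (e x) (e y)) : Iso A B where
  toEquiv := e
  map_part := by
    have hd := Submodule.disjoint_def.1 B.isCompl.disjoint
    intro i
    refine le_antisymm (Submodule.map_le_iff_le_comap.2 (hp i)) fun x hx => ?_
    obtain ⟨u, hu, v, hv, h⟩ := A.exists_homogeneous (e.symm x)
    have h' : e u + e v = x := by rw [← map_add, h, e.apply_symm_apply]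
    rcases (by decide : ∀ s : ZMod 2, s = 0 ∨ s = 1) i with rfl | rfl
    · refine ⟨u, hu, ?_⟩
      -- The parts of `B` are disjoint, so a component of the wrong parity in the preimage must
      -- vanish. This gives equality from the inclusions alone.
      have := hd (e v) (by
        rw [← h'] at hx; simpa using sub_mem hx (hp 0 u hu)) (hp 1 v hv)
      rw [← h', this, add_zero]; rfl
    · refine ⟨v, hv, ?_⟩
      have := hd (e u) (hp 0 u hu) (by
        rw [← h'] at hx; simpa using sub_mem hx (hp 1 v hv))
      rw [← h', this, zero_add]; rfl
  map_bracket := hb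

theorem Iso.mem_part_iff {A : LeibnizSuperalgebra L} {B : LeibnizSuperalgebra L'} (f : Iso A B)
    (i : ZMod 2) (x : L) : f.toEquiv x ∈ B.part i ↔ x ∈ A.part i := by
  rw [← f.map_part i]
  constructor
  · rintro ⟨y, hy, h⟩
    rwa [← f.toEquiv.injective h]
  · exact fun h => ⟨x, h, rfl⟩

/-- The inverse isomorphism. -/
def Iso.symm {A : LeibnizSuperalgebra L} {B : LeibnizSuperalgebra L'} (f : Iso A B) :
    Iso B A :=
  Iso.ofLE f.toEquiv.symm
    (fun i x hx => by rw [← f.mem_part_iff, f.toEquiv.apply_symm_apply]; exact hx)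
    (fun x y => f.toEquiv.injective (by simp [f.map_bracket]))

/-- A superalgebra with a basis multiplied according to a table is given by that table. -/
theorem nonempty_iso_ofTable {ι : Type*} {p : ι → ZMod 2} {c : ι → ι → (ι →₀ ℂ)}
    {hc : ∀ i j, c i j ∈ Finsupp.supported ℂ ℂ {k | p k = p i + p j}}
    {hl : ∀ i j k, tableBracket c (Finsupp.single i 1) (c j k) =
      tableBracket c (c i j) (Finsupp.single k 1) -
        (-1 : ℂ) ^ ((p j).val * (p k).val) • tableBracket c (c i k) (Finsupp.single j 1)}
    (A : LeibnizSuperalgebra L) (b : ι → L)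
    (hbij : Function.Bijective (Finsupp.linearCombination ℂ b))
    (hpart : ∀ i, b i ∈ A.part (p i))
    (hmul : ∀ i j, A.bracket (b i) (b j) = Finsupp.linearCombination ℂ b (c i j)) :
    Nonempty (Iso (ofTable p c hc hl) A) := by
  refine ⟨Iso.ofLE (LinearEquiv.ofBijective _ hbij) ?_ ?_⟩
  · intro i x hx
    change x ∈ Finsupp.supported ℂ ℂ {k | p k = i} at hx
    rw [LinearEquiv.ofBijective_apply, Finsupp.linearCombination_apply]
    refine Submodule.sum_mem _ fun k hk => Submodule.smul_mem _ _ ?_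
    have : p k = i := (Finsupp.mem_supported _ _).1 hx hk
    exact this ▸ hpart k
  · have h : (tableBracket c).compr₂ (Finsupp.linearCombination ℂ b) =
        A.bracket.compl₁₂ (Finsupp.linearCombination ℂ b) (Finsupp.linearCombination ℂ b) := by
      ext i j
      simp [tableBracket_single, hmul]
    exact fun x y => LinearMap.congr_fun₂ h x y

end

/-- The eigenvalue `d k` does not recur further down the flag, so an eigenvector is determined by
its leading coefficient. -/
theorem Triangular.eq_smul {L : Type*} [AddCommGroup L] [Module ℂ L] [FiniteDimensional ℂ L]
    {T : L →ₗ[ℂ] L} {Z : ℕ → L} {d : ℕ → ℂ} {k₀ : ℕ} (h : Triangular T Z d k₀) {K : ℕ}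
    (hZ : ∀ i, K ≤ i → Z i = 0) {k : ℕ} (hk : k₀ ≤ k) (hd : ∀ l, k < l → d l ≠ d k) {e w : L}
    (he : e - Z k ∈ flag Z (k + 1)) (het : T e = d k • e) {c : ℂ}
    (hw : w - c • Z k ∈ flag Z (k + 1)) (hwt : T w = d k • w) : w = c • e := by
  rw [← sub_eq_zero]
  refine (h.mono (hk.trans k.le_succ)).eq_zero hZ (s := d k) (fun l hl => hd l hl) ?_ ?_
  · have : w - c • e = (w - c • Z k) - c • (e - Z k) := by rw [smul_sub]; abel
    rw [this]
    exact sub_mem hw (Submodule.smul_mem _ _ he)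
  · rw [map_sub, map_smul, het, hwt, smul_sub, smul_comm]

/-! ### Elements annihilated by the diagonalised one, and the weight map -/

section Torus
variable {L : Type*} [AddCommGroup L] [Module ℂ L]
  {A : LeibnizSuperalgebra L} {n m : ℕ} {N : Submodule ℂ L} {X Y e g : ℕ → L}
  {cX cY : ℕ → L →ₗ[ℂ] ℂ}

namespace LPCoframe

theorem natCast_add_one_ne {k l : ℕ} (h : k < l) : ((l : ℂ) + 1) ≠ (k : ℂ) + 1 := by
  norm_cast; omega

/-- Products of the eigenframe with an element commuting with the diagonalised one. -/
theorem torus_table [FiniteDimensional ℂ L] (F : LPCoframe A n m N X Y cX cY) (hn : 3 ≤ n) (hm : 2 ≤ m) {t h : L}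
    (ht : t ∈ A.part 0)
    (hX : Triangular (A.right t) X (fun k => (k : ℂ) + 1) 0)
    (hY : Triangular (A.right t) Y (fun k => (k : ℂ) + 1) 0)
    (E : LPFrame A n m e g) (eX : ∀ k, e k - X k ∈ flag X (k + 1))
    (gY : ∀ k, g k - Y k ∈ flag Y (k + 1))
    (et : ∀ k, A.bracket (e k) t = ((k : ℂ) + 1) • e k)
    (gt : ∀ k, A.bracket (g k) t = ((k : ℂ) + 1) • g k)
    (hh : h ∈ A.part 0) (hht : A.bracket h t = 0) {α β γ : ℂ}
    (hX' : Triangular (A.right h) X (xWeight α β) 0)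
    (hY' : Triangular (A.right h) Y (yWeight α γ) 0) :
    (∀ k, A.bracket (e k) h = xWeight α β k • e k) ∧
    (∀ k, A.bracket (g k) h = yWeight α γ k • g k) ∧
    A.bracket h (e 0) = -α • e 0 ∧ (∀ k, A.bracket h (e (k + 1)) = 0) ∧
    (∀ k, A.bracket h (g k) = 0) := by
  have hht' : A.bracket h t = (0 : ℂ) • h := by rw [hht, zero_smul]
  have cong : ∀ {Z : ℕ → L} {k : ℕ} {u : L} {c : ℂ}, u - Z k ∈ flag Z (k + 1) →
      ∀ {w : L}, w - c • u ∈ flag Z (k + 1) → w - c • Z k ∈ flag Z (k + 1) := by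
    intro Z k u c hu w hw
    have : w - c • Z k = (w - c • u) + c • (u - Z k) := by rw [smul_sub]; abel
    rw [this]
    exact add_mem hw (Submodule.smul_mem _ _ hu)
  -- Because `[h, t] = 0`, `[e k, h]` keeps the `t`-eigenvalue of `e k`; hence it is a multiple of
  -- `e k`, with the diagonal entry of `R_h` as factor.
  have eh : ∀ k, A.bracket (e k) h = xWeight α β k • e k := fun k =>
    Triangular.eq_smul hX F.X_zero (Nat.zero_le k) (fun l hl => natCast_add_one_ne hl) (eX k)
      (et k) (cong (eX k) (hX'.sub_smul_mem (e k) (Nat.zero_le k) (eX k)))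
      (by simpa using bracket_bracket_eigen ht (et k) hht')
  have gh : ∀ k, A.bracket (g k) h = yWeight α γ k • g k := fun k =>
    Triangular.eq_smul hY F.Y_zero (Nat.zero_le k) (fun l hl => natCast_add_one_ne hl) (gY k)
      (gt k) (cong (gY k) (hY'.sub_smul_mem (g k) (Nat.zero_le k) (gY k)))
      (by simpa using bracket_bracket_eigen ht (gt k) hht')
  have het : ∀ k, A.bracket (A.bracket h (e k)) t = ((k : ℂ) + 1) • A.bracket h (e k) :=
    fun k => by simpa using bracket_bracket_eigen ht hht' (et k)
  have hgt : ∀ k, A.bracket (A.bracket h (g k)) t = ((k : ℂ) + 1) • A.bracket h (g k) :=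
    fun k => by simpa using bracket_bracket_eigen ht hht' (gt k)
  have he0 : A.bracket h (e 0) = -α • e 0 := by
    obtain ⟨u, hu⟩ := flag_decomp (F.bracket_even_even hh (E.X_even 0))
    have h1 := Triangular.eq_smul hX F.X_zero le_rfl (fun l hl => natCast_add_one_ne hl)
      (eX 0) (et 0) hu (het 0)
    -- In `[e 1, [h, e 0]] = [[e 1, h], e 0] - [[e 1, e 0], h]` the coefficients of `e 2` give `u =
    -- β - (β + α)`.
    have h2 := A.leibniz_even hh (e 1) (e 0)
    rw [h1, map_smul, E.X_succ_zero 0, eh 1, map_smul, LinearMap.smul_apply, E.X_succ_zero 0,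
      eh 2, ← sub_eq_zero] at h2
    have h3 : (u + α) • e 2 = 0 := by
      rw [← h2]; simp only [xWeight]; push_cast; module
    have h4 := (smul_eq_zero.1 h3).resolve_right (F.X_ne_zero (k := 2) (by omega) (eX 2))
    rw [h1, eq_neg_of_add_eq_zero_left h4]
  have he1 : A.bracket h (e 1) = 0 := by
    have hw := F.bracket_even_even hh (E.X_even 1)
    obtain ⟨c, hc⟩ := flag_decomp hw
    -- `R_t - 1` maps `flag X 0` into `flag X 1` and fixes this vector, whose `t`-eigenvalue is `2`.
    have hw1 : A.bracket h (e 1) ∈ flag X 1 := by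
      have h1 := (hX.mono (Nat.zero_le 1)).map_mem le_rfl hc
      have h2 := Submodule.smul_mem _ c (hX 0 le_rfl)
      have h3 := sub_mem (add_mem h1 h2) hc
      rw [map_sub, map_smul, right_apply, het 1, right_apply] at h3
      convert h3 using 1
      push_cast
      module
    obtain ⟨u, hu⟩ := flag_decomp hw1
    have h1 := Triangular.eq_smul hX F.X_zero (Nat.zero_le 1)
      (fun l hl => natCast_add_one_ne hl) (eX 1) (et 1) hu (het 1)
    -- Expanding `[h, [e 0, e 1]] = 0` leaves only `[[h, e 1], e 0] = u • e 2`, so `u = 0`.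
    have h2 := A.leibniz_even (E.X_even 0) h (e 1)
    rw [E.X_X_succ, map_zero, he0, map_smul, LinearMap.smul_apply, E.X_X_succ, smul_zero,
      zero_sub, h1, map_smul, LinearMap.smul_apply, E.X_succ_zero 0, eq_comm,
      neg_eq_zero] at h2
    have h4 := (smul_eq_zero.1 h2).resolve_right (F.X_ne_zero (k := 2) (by omega) (eX 2))
    rw [h1, h4, zero_smul]
  have hg0 : A.bracket h (g 0) = 0 := by
    obtain ⟨u, hu⟩ := flag_decomp (F.bracket_even_odd hh (E.Y_odd 0))
    have h1 := Triangular.eq_smul hY F.Y_zero (Nat.zero_le 0)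
      (fun l hl => natCast_add_one_ne hl) (gY 0) (gt 0) hu (hgt 0)
    have h2 := A.leibniz_even (E.X_even 0) h (g 0)
    rw [E.X_Y, map_zero, he0, map_smul, LinearMap.smul_apply, E.X_Y, smul_zero,
      zero_sub, h1, map_smul, LinearMap.smul_apply, E.Y_X_zero 0, eq_comm, neg_eq_zero] at h2
    have h4 := (smul_eq_zero.1 h2).resolve_right (F.Y_ne_zero (k := 1) (by omega) (gY 1))
    rw [h1, h4, zero_smul]
  refine ⟨eh, gh, he0, fun k => ?_, fun k => ?_⟩
  · induction k with
    | zero => exact he1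
    | succ k ih =>
      have h2 := A.leibniz_even (E.X_even (k + 1)) h (e 0)
      rwa [E.X_succ_zero, ih, map_zero, LinearMap.zero_apply, he0, map_smul,
        LinearMap.smul_apply, E.X_X_succ, smul_zero, sub_zero] at h2
  · induction k with
    | zero => exact hg0
    | succ k ih =>
      have h2 := A.right_even (E.X_even 0) h (g k)
      rwa [E.Y_X_zero, ih, map_zero, LinearMap.zero_apply, he0, map_smul,
        LinearMap.smul_apply, E.X_Y, smul_zero, add_zero, eq_comm] at h2

/-- The weights of an element: the diagonal entries of its action on `X 0`, `X 1`, `Y 0`. -/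
def weights (A : LeibnizSuperalgebra L) (X Y : ℕ → L) (cX cY : ℕ → L →ₗ[ℂ] ℂ) :
    L →ₗ[ℂ] ℂ × ℂ × ℂ :=
  (cX 0 ∘ₗ A.bracket (X 0)).prod
    ((cX 1 ∘ₗ A.bracket (X 1)).prod (cY 0 ∘ₗ A.bracket (Y 0)))

theorem weights_apply (q : L) : weights A X Y cX cY q =
    (cX 0 (A.bracket (X 0) q), cX 1 (A.bracket (X 1) q), cY 0 (A.bracket (Y 0) q)) := rfl

theorem triangular_X_of_weights (F : LPCoframe A n m N X Y cX cY) (hn : 3 ≤ n) {q : L}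
    (hq : q ∈ A.part 0) {α β γ : ℂ} (hw : weights A X Y cX cY q = (α, β, γ)) :
    Triangular (A.right q) X (xWeight α β) 0 := by
  have h := F.triangular_X hn hq
  simp only [weights_apply, Prod.mk.injEq] at hw
  rwa [hw.1, hw.2.1] at h

theorem triangular_Y_of_weights (F : LPCoframe A n m N X Y cX cY) (hn : 3 ≤ n) (hm : 2 ≤ m)
    {q : L} (hq : q ∈ A.part 0) {α β γ : ℂ} (hw : weights A X Y cX cY q = (α, β, γ)) :
    Triangular (A.right q) Y (yWeight α γ) 0 := by
  have h := F.triangular_Y hn hm hq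
  simp only [weights_apply, Prod.mk.injEq] at hw
  rwa [hw.1, hw.2.2] at h

theorem weights_odd (F : LPCoframe A n m N X Y cX cY) (hN : A.IsNilradical N) {v : L}
    (hv : v ∈ A.part 1) : weights A X Y cX cY v = 0 := by
  have hv' := F.odd_le ⟨hN.odd_le F.square_le hv, hv⟩
  rw [weights_apply, F.bracket_X_Y (mem_flag X le_rfl) hv',
    F.bracket_X_Y (mem_flag X (Nat.zero_le 1)) hv', F.bracket_Y_Y (mem_flag Y le_rfl) hv']
  simp

/-- Only the `X 0` component acts on `N`, and it acts strictly triangularly. Corrections by even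
elements of `N` therefore keep the weights. -/
theorem weights_flag (F : LPCoframe A n m N X Y cX cY) (hn : 3 ≤ n) (hm : 2 ≤ m) {v : L}
    (hv : v ∈ flag X 0) : weights A X Y cX cY v = 0 := by
  obtain ⟨c, hc⟩ := flag_decomp hv
  have h1 : A.bracket (X 1) (X 0) = X 2 := F.X_succ_zero 0
  have h2 : A.bracket (Y 0) (X 0) = Y 1 := F.Y_X_zero 0
  rw [weights_apply, F.bracket_X_congr (mem_flag X le_rfl) hc,
    F.bracket_X_congr (mem_flag X (Nat.zero_le 1)) hc,
    F.bracket_Y_congr (mem_flag Y le_rfl) hc]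
  simp [F.X_zero_zero, h1, h2, F.cX_X 1 2 (by omega), F.cY_Y 0 1 (by omega)]

theorem le_flag_sup (F : LPCoframe A n m N X Y cX cY) (hN : A.IsNilradical N) :
    N ≤ flag X 0 ⊔ flag Y 0 :=
  hN.isIdeal.graded.trans (sup_le_sup F.even_le F.odd_le)

theorem exists_even_weights_eq (F : LPCoframe A n m N X Y cX cY) (hN : A.IsNilradical N)
    (q : L) : ∃ u ∈ A.part 0, weights A X Y cX cY u = weights A X Y cX cY q ∧ q - u ∈ N := by
  obtain ⟨u, hu, v, hv, rfl⟩ := A.exists_homogeneous q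
  exact ⟨u, hu, by rw [map_add, F.weights_odd hN hv, add_zero],
    by simpa using hN.odd_le F.square_le hv⟩

/-- An element has the weights of its even component. If they vanish, that component acts on both
chains with zero diagonal, hence nilpotently on `N`, and so belongs to `N`. -/
theorem ker_weights_le (F : LPCoframe A n m N X Y cX cY) (hn : 3 ≤ n) (hm : 2 ≤ m)
    (hN : A.IsNilradical N) : LinearMap.ker (weights A X Y cX cY) ≤ N := by
  intro q hq
  rw [LinearMap.mem_ker] at hq
  obtain ⟨u, hu, huq, hd⟩ := F.exists_even_weights_eq hN q
  rw [hq] at huq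
  have hX := F.triangular_X_of_weights hn hu huq
  have hY := F.triangular_Y_of_weights hn hm hu huq
  have h0 : xWeight 0 0 = 0 := by ext (_ | k) <;> simp [xWeight]
  have h0' : yWeight 0 0 = 0 := by ext k; simp [yWeight]
  rw [h0] at hX
  rw [h0'] at hY
  rw [← sub_add_cancel q u]
  refine add_mem hd (hN.mem_of_right_pow_eq_zero F.square_le hu (n + m) fun x hx => ?_)
  obtain ⟨a, ha, b, hb, rfl⟩ := Submodule.mem_sup.1 (F.le_flag_sup hN hx)
  rw [map_add]
  nth_rw 1 [add_comm n m]
  rw [pow_add, pow_add, Module.End.mul_apply, Module.End.mul_apply,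
    hX.pow_eq_zero F.X_zero ha, hY.pow_eq_zero F.Y_zero hb]
  simp

/-- The kernel has dimension at most `n + m`, so the image in `ℂ³` has dimension at least `3`. -/
theorem weights_surjective [FiniteDimensional ℂ L] (F : LPCoframe A n m N X Y cX cY) (hn : 3 ≤ n) (hm : 2 ≤ m)
    (hN : A.IsNilradical N) (hNd : Module.finrank ℂ N = n + m)
    (hdim : n + m + 3 ≤ Module.finrank ℂ L) :
    Function.Surjective (weights A X Y cX cY) := by
  rw [← LinearMap.range_eq_top]
  apply Submodule.eq_top_of_finrank_eq
  have h1 := LinearMap.finrank_range_add_finrank_ker (weights A X Y cX cY)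
  have h2 := Submodule.finrank_mono (F.ker_weights_le hn hm hN)
  have h3 := Submodule.finrank_le (LinearMap.range (weights A X Y cX cY))
  have h4 : Module.finrank ℂ (ℂ × ℂ × ℂ) = 3 := by simp
  omega

end LPCoframe

end Torus

end LeibnizSuperalgebra

/-! ### Dimensions, and reconstruction of the multiplication table -/

namespace LeibnizSuperalgebra

/-- The basis vectors of `LP^{n,m}` are the `x` and the `y`. -/
def LPIndex.equivSum (n m : ℕ) : LPIndex n m ≃ Fin n ⊕ Fin m where
  toFun
    | .x i => .inl i
    | .y j => .inr j
  invFun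
    | .inl i => .x i
    | .inr j => .y j
  left_inv := by rintro (_ | _) <;> rfl
  right_inv := by rintro (_ | _) <;> rfl

theorem LPIndex.finrank (n m : ℕ) : Module.finrank ℂ (LPIndex n m →₀ ℂ) = n + m := by
  rw [(Finsupp.domLCongr (LPIndex.equivSum n m) : _ ≃ₗ[ℂ] (_ →₀ ℂ)).finrank_eq]
  simp

/-- The basis vectors of `SLP^{n,m}` are those of `LP^{n,m}` and three more. -/
def SLPIndex.equivSum (n m : ℕ) : SLPIndex n m ≃ (Fin n ⊕ Fin m) ⊕ Fin 3 where
  toFun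
    | .x i => .inl (.inl i)
    | .y j => .inl (.inr j)
    | .t1 => .inr 0
    | .t2 => .inr 1
    | .t3 => .inr 2
  invFun
    | .inl (.inl i) => .x i
    | .inl (.inr j) => .y j
    | .inr 0 => .t1
    | .inr 1 => .t2
    | .inr 2 => .t3
  left_inv := by rintro (_ | _ | _ | _ | _) <;> rfl
  right_inv := by
    rintro ((_ | _) | i)
    · rfl
    · rfl
    · fin_cases i <;> rfl

theorem SLPIndex.finrank (n m : ℕ) : Module.finrank ℂ (SLPIndex n m →₀ ℂ) = n + m + 3 := by
  rw [(Finsupp.domLCongr (SLPIndex.equivSum n m) : _ ≃ₗ[ℂ] (_ →₀ ℂ)).finrank_eq]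
  simp

instance (n m : ℕ) : Finite (SLPIndex n m) := Finite.of_equiv _ (SLPIndex.equivSum n m).symm

section
variable {L : Type*} [AddCommGroup L] [Module ℂ L] {A : LeibnizSuperalgebra L} {n m : ℕ}
  {N : Submodule ℂ L}

theorem exists_coframe (hn : 0 < n) (hN : A.IsIdeal N) (hsq : A.square ≤ N)
    (f : Iso (A.ofIdeal N hN) (LP n m)) :
    ∃ (X Y : ℕ → L) (cX cY : ℕ → L →ₗ[ℂ] ℂ), LPCoframe A n m N X Y cX cY := by
  classical
  let K : (LPIndex n m →₀ ℂ) →ₗ[ℂ] L := N.subtype ∘ₗ f.toEquiv.symm.toLinearMap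
  have hK : ∀ u v, A.bracket (K u) (K v) = K (tableBracket LPIndex.table u v) := fun u v =>
    congrArg Subtype.val (f.symm.map_bracket u v).symm
  have hKp : ∀ i, ∀ u ∈ Finsupp.supported ℂ ℂ {k | LPIndex.parity k = i}, K u ∈ A.part i :=
    fun i u hu => (f.symm.mem_part_iff i u).2 hu
  -- Extending the coordinates of `N` to all of `L` makes the weights linear functions on `L`.
  obtain ⟨π, hπ⟩ := LinearMap.exists_extend f.toEquiv.toLinearMap
  have hπK : ∀ u, π (K u) = u := fun u => by
    have := LinearMap.congr_fun hπ (f.toEquiv.symm u)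
    simpa [K] using this
  let X : ℕ → L := fun k => if h : k < n then K (Finsupp.single (.x ⟨k, h⟩) 1) else 0
  let Y : ℕ → L := fun k => if h : k < m then K (Finsupp.single (.y ⟨k, h⟩) 1) else 0
  have X_lt : ∀ k (h : k < n), X k = K (Finsupp.single (.x ⟨k, h⟩) 1) := fun k h => dif_pos h
  have Y_lt : ∀ k (h : k < m), Y k = K (Finsupp.single (.y ⟨k, h⟩) 1) := fun k h => dif_pos h
  have X_ge : ∀ k, n ≤ k → X k = 0 := fun k h => dif_neg (by omega)
  have Y_ge : ∀ k, m ≤ k → Y k = 0 := fun k h => dif_neg (by omega)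
  have hnX : ∀ k : Fin n, K (LPIndex.nextX k) = X (k.val + 1) := by
    intro k
    unfold LPIndex.nextX
    split_ifs with h
    · rw [X_lt _ h]
    · rw [X_ge _ (by omega), map_zero]
  have hnY : ∀ k : Fin m, K (LPIndex.nextY k) = Y (k.val + 1) := by
    intro k
    unfold LPIndex.nextY
    split_ifs with h
    · rw [Y_lt _ h]
    · rw [Y_ge _ (by omega), map_zero]
  refine ⟨X, Y, fun k => if h : k < n then Finsupp.lapply (.x ⟨k, h⟩) ∘ₗ π else 0,
    fun k => if h : k < m then Finsupp.lapply (.y ⟨k, h⟩) ∘ₗ π else 0, ⟨⟨?_, ?_, X_ge, Y_ge,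
      ?_, ?_, ?_, ?_, ?_, ?_, ?_⟩, hsq, ?_, ?_, ?_, ?_⟩⟩
  · intro k
    by_cases hk : k < n
    · rw [X_lt k hk]
      exact hKp 0 _ (Finsupp.single_mem_supported _ _ rfl)
    · rw [X_ge k (by omega)]; exact zero_mem _
  · intro k
    by_cases hk : k < m
    · rw [Y_lt k hk]
      exact hKp 1 _ (Finsupp.single_mem_supported _ _ rfl)
    · rw [Y_ge k (by omega)]; exact zero_mem _
  · intro k l
    by_cases hk : k < n
    · by_cases hl : l + 1 < n
      · rw [X_lt k hk, X_lt _ hl, hK, tableBracket_single]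
        simp [LPIndex.table]
      · rw [X_ge _ (by omega : n ≤ l + 1), map_zero]
    · rw [X_ge k (by omega), map_zero, LinearMap.zero_apply]
  · by_cases hk : 0 < n
    · rw [X_lt 0 hk, hK, tableBracket_single]
      simp [LPIndex.table]
    · rw [X_ge 0 (by omega), map_zero]
  · intro k
    by_cases hk : k + 1 < n
    · rw [X_lt _ hk, X_lt 0 (by omega), hK, tableBracket_single]
      simp [LPIndex.table, hnX]
    · rw [X_ge (k + 1) (by omega), X_ge (k + 2) (by omega), map_zero, LinearMap.zero_apply]
  · intro k l
    by_cases hk : k < m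
    · by_cases hl : l + 1 < n
      · rw [Y_lt k hk, X_lt _ hl, hK, tableBracket_single]
        simp [LPIndex.table]
      · rw [X_ge _ (by omega : n ≤ l + 1), map_zero]
    · rw [Y_ge k (by omega), map_zero, LinearMap.zero_apply]
  · intro k
    by_cases hk : k < m
    · rw [Y_lt k hk, X_lt 0 hn, hK, tableBracket_single]
      simp [LPIndex.table, hnY]
    · rw [Y_ge k (by omega), Y_ge (k + 1) (by omega), map_zero, LinearMap.zero_apply]
  · intro k l
    by_cases hk : k < n
    · by_cases hl : l < m
      · rw [X_lt k hk, Y_lt _ hl, hK, tableBracket_single]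
        simp [LPIndex.table]
      · rw [Y_ge l (by omega), map_zero]
    · rw [X_ge k (by omega), map_zero, LinearMap.zero_apply]
  · intro k l
    by_cases hk : k < m
    · by_cases hl : l < m
      · rw [Y_lt k hk, Y_lt _ hl, hK, tableBracket_single]
        simp [LPIndex.table]
      · rw [Y_ge l (by omega), map_zero]
    · rw [Y_ge k (by omega), map_zero, LinearMap.zero_apply]
  · rintro v ⟨hv, hv0⟩
    have h : f.toEquiv ⟨v, hv⟩ ∈ (LP n m).part 0 := (f.mem_part_iff 0 _).2 hv0
    change _ ∈ Finsupp.supported ℂ ℂ {k | LPIndex.parity k = 0} at h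
    have hle : Finsupp.supported ℂ ℂ {k | LPIndex.parity (n := n) (m := m) k = 0} ≤
        (flag X 0).comap K := by
      rw [Finsupp.supported_eq_span_single, Submodule.span_le]
      rintro _ ⟨k | k, hk, rfl⟩
      · rw [SetLike.mem_coe, Submodule.mem_comap, ← X_lt _ k.2]
        exact mem_flag X (Nat.zero_le _)
      · exact absurd hk (by decide : (1 : ZMod 2) ≠ 0)
    simpa [K] using hle h
  · rintro v ⟨hv, hv0⟩
    have h : f.toEquiv ⟨v, hv⟩ ∈ (LP n m).part 1 := (f.mem_part_iff 1 _).2 hv0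
    change _ ∈ Finsupp.supported ℂ ℂ {k | LPIndex.parity k = 1} at h
    have hle : Finsupp.supported ℂ ℂ {k | LPIndex.parity (n := n) (m := m) k = 1} ≤
        (flag Y 0).comap K := by
      rw [Finsupp.supported_eq_span_single, Submodule.span_le]
      rintro _ ⟨k | k, hk, rfl⟩
      · exact absurd hk (by decide : (0 : ZMod 2) ≠ 1)
      · rw [SetLike.mem_coe, Submodule.mem_comap, ← Y_lt _ k.2]
        exact mem_flag Y (Nat.zero_le _)
    simpa [K] using hle h
  · intro k l hk
    by_cases hl : l < n
    · simp [hk, X_lt l hl, hπK, Finsupp.single_apply, eq_comm]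
    · rw [X_ge l (by omega), map_zero, if_neg (by omega)]
  · intro k l hk
    by_cases hl : l < m
    · simp [hk, Y_lt l hl, hπK, Finsupp.single_apply, eq_comm]
    · rw [Y_ge l (by omega), map_zero, if_neg (by omega)]

/-- A Leibniz superalgebra of dimension at least `n + m + 3` whose square is contained in the
nilradical, isomorphic to `LP^{n,m}`, is isomorphic to `SLP^{n,m}`. -/
theorem nonempty_iso_SLP [FiniteDimensional ℂ L] (hn : 3 ≤ n) (hm : 2 ≤ m)
    (hN : A.IsNilradical N) (hsq : A.square ≤ N) (f : Iso (A.ofIdeal N hN.isIdeal) (LP n m))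
    (hdim : n + m + 3 ≤ Module.finrank ℂ L) : Nonempty (Iso A (SLP n m)) := by
  obtain ⟨X, Y, cX, cY, F⟩ := exists_coframe (by omega) hN.isIdeal hsq f
  have hNd : Module.finrank ℂ N = n + m := by rw [f.toEquiv.finrank_eq, LPIndex.finrank]
  have hsurj := F.weights_surjective hn hm hN hNd hdim
  have heven : ∀ a, ∃ u ∈ A.part 0, LPCoframe.weights A X Y cX cY u = a := fun a => by
    obtain ⟨q, rfl⟩ := hsurj a
    obtain ⟨u, hu, h, -⟩ := F.exists_even_weights_eq hN q
    exact ⟨u, hu, h⟩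
  -- The weights `(1, 2, 1)` give the diagonal entries `k + 1` on both chains: distinct along each
  -- chain and never zero.
  obtain ⟨t, ht, htw⟩ := heven (1, 2, 1)
  have hX : Triangular (A.right t) X (fun k => (k : ℂ) + 1) 0 := by
    convert F.triangular_X_of_weights hn ht htw using 1
    ext (_ | k) <;> simp [xWeight]
    ring
  have hY : Triangular (A.right t) Y (fun k => (k : ℂ) + 1) 0 := by
    convert F.triangular_Y_of_weights hn hm ht htw using 1
    ext k
    simp [yWeight, add_comm]
  obtain ⟨e, g, E, eX, gY, et, gt⟩ := F.exists_eigenframe ht hX hY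
  have hk0 : ∀ k : ℕ, 0 ≤ k → (k : ℂ) + 1 ≠ 0 := fun k _ => Nat.cast_add_one_ne_zero k
  have htorus : ∀ a, ∃ h ∈ A.part 0, A.bracket h t = 0 ∧
      LPCoframe.weights A X Y cX cY h = a := fun a => by
    obtain ⟨s, hs, hsa⟩ := heven a
    -- `R_t` is invertible on the even part of `N`, which contains `[s, t]`; so `[s, t] = [v, t]`
    -- for some `v` there, and `s - v` is annihilated by `t`.
    obtain ⟨v, hv, hvt⟩ := hX.exists_sub_smul_eq F.X_zero hk0 (F.bracket_even_even hs ht)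
    rw [zero_smul, sub_zero, right_apply] at hvt
    refine ⟨s - v, sub_mem hs (F.flag_X_even 0 hv), ?_, ?_⟩
    · rw [map_sub, LinearMap.sub_apply, hvt, sub_self]
    · rw [map_sub, F.weights_flag hn hm hv, sub_zero, hsa]
  obtain ⟨t₁, h₁, h₁t, w₁⟩ := htorus (1, 0, 0)
  obtain ⟨t₂, h₂, h₂t, w₂⟩ := htorus (0, 1, 0)
  obtain ⟨t₃, h₃, h₃t, w₃⟩ := htorus (0, 0, 1)
  -- `[h, h']` lies in the even part of `N` and is killed by `R_t`, which is injective there.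
  have habel : ∀ h ∈ A.part 0, A.bracket h t = 0 → ∀ h' ∈ A.part 0, A.bracket h' t = 0 →
      A.bracket h h' = 0 := fun h hh hht h' hh' hht' =>
    hX.eq_zero F.X_zero hk0 (F.bracket_even_even hh hh')
      (by rw [right_apply, A.right_even ht, hht, hht']; simp)
  obtain ⟨e₁, g₁, l₁, le₁, lg₁⟩ := F.torus_table hn hm ht hX hY E eX gY et gt h₁ h₁t
    (F.triangular_X_of_weights hn h₁ w₁) (F.triangular_Y_of_weights hn hm h₁ w₁)
  obtain ⟨e₂, g₂, l₂, le₂, lg₂⟩ := F.torus_table hn hm ht hX hY E eX gY et gt h₂ h₂t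
    (F.triangular_X_of_weights hn h₂ w₂) (F.triangular_Y_of_weights hn hm h₂ w₂)
  obtain ⟨e₃, g₃, l₃, le₃, lg₃⟩ := F.torus_table hn hm ht hX hY E eX gY et gt h₃ h₃t
    (F.triangular_X_of_weights hn h₃ w₃) (F.triangular_Y_of_weights hn hm h₃ w₃)
  let b : SLPIndex n m → L
    | .x i => e i
    | .t1 => t₁
    | .t2 => t₂
    | .t3 => t₃
    | .y j => g j
  have hbr : ∀ i, b i ∈ LinearMap.range (Finsupp.linearCombination ℂ b) := fun i =>
    ⟨Finsupp.single i 1, by simp⟩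
  have hNr : N ≤ LinearMap.range (Finsupp.linearCombination ℂ b) := by
    refine (F.le_flag_sup hN).trans (sup_le ?_ ?_)
    · refine (flag_le_flag F.X_zero eX 0).trans (flag_le fun i _ => ?_)
      by_cases hi : i < n
      · exact hbr (.x ⟨i, hi⟩)
      · rw [E.X_zero i (by omega)]; exact zero_mem _
    · refine (flag_le_flag F.Y_zero gY 0).trans (flag_le fun i _ => ?_)
      by_cases hi : i < m
      · exact hbr (.y ⟨i, hi⟩)
      · rw [E.Y_zero i (by omega)]; exact zero_mem _
  have hs : Function.Surjective (Finsupp.linearCombination ℂ b) := by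
    rw [← LinearMap.range_eq_top, eq_top_iff]
    intro l _
    obtain ⟨⟨p, q, r⟩, hw⟩ : ∃ a, LPCoframe.weights A X Y cX cY l = a := ⟨_, rfl⟩
    have hker : l - (p • t₁ + q • t₂ + r • t₃) ∈ N := F.ker_weights_le hn hm hN (by
      rw [LinearMap.mem_ker, map_sub, map_add, map_add, map_smul, map_smul, map_smul, hw,
        w₁, w₂, w₃]
      simp)
    rw [← sub_add_cancel l (p • t₁ + q • t₂ + r • t₃)]
    exact add_mem (hNr hker) (add_mem (add_mem (Submodule.smul_mem _ _ (hbr .t1))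
      (Submodule.smul_mem _ _ (hbr .t2))) (Submodule.smul_mem _ _ (hbr .t3)))
  -- Spanning suffices: it bounds `dim L` by `n + m + 3`, the assumed lower bound, and independence
  -- follows.
  have hfin : Module.finrank ℂ (SLPIndex n m →₀ ℂ) = Module.finrank ℂ L :=
    le_antisymm (by rwa [SLPIndex.finrank]) (LinearMap.finrank_le_finrank_of_surjective hs)
  have hbij : Function.Bijective (Finsupp.linearCombination ℂ b) :=
    ⟨(LinearMap.injective_iff_surjective_of_finrank_eq_finrank hfin).2 hs, hs⟩
  have hnX : ∀ k : Fin n,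
      Finsupp.linearCombination ℂ b (SLPIndex.nextX k) = e (k.val + 1) := by
    intro k
    unfold SLPIndex.nextX
    split_ifs with h
    · simp [b]
    · rw [E.X_zero _ (by omega), map_zero]
  have hnY : ∀ k : Fin m,
      Finsupp.linearCombination ℂ b (SLPIndex.nextY k) = g (k.val + 1) := by
    intro k
    unfold SLPIndex.nextY
    split_ifs with h
    · simp [b]
    · rw [E.Y_zero _ (by omega), map_zero]
  obtain ⟨Φ⟩ : Nonempty (Iso (SLP n m) A) := by
    refine nonempty_iso_ofTable A b hbij ?_ ?_
    · rintro (i | _ | _ | _ | i)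
      · exact E.X_even i
      · exact h₁
      · exact h₂
      · exact h₃
      · exact E.Y_odd i
    · rintro (⟨_ | i, hi⟩ | _ | _ | _ | ⟨i, hi⟩) (⟨_ | j, hj⟩ | _ | _ | _ | ⟨j, hj⟩) <;>
        simp [b, SLPIndex.table, hnX, hnY, E.X_X_succ, E.X_zero_zero, E.X_succ_zero,
          E.Y_X_succ, E.Y_X_zero, E.X_Y, E.Y_Y, e₁, e₂, e₃, g₁, g₂, g₃, l₁, l₂, l₃, le₁, le₂,
          le₃, lg₁, lg₂, lg₃, habel, h₁, h₂, h₃, h₁t, h₂t, h₃t, xWeight, yWeight]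
  exact ⟨Φ.symm⟩

end
end LeibnizSuperalgebra

namespace LeibnizSuperalgebra

/-! ### Transport along isomorphisms -/

section Transport
variable {L L' L'' : Type*} [AddCommGroup L] [Module ℂ L] [AddCommGroup L'] [Module ℂ L']
  [AddCommGroup L''] [Module ℂ L''] {A : LeibnizSuperalgebra L} {B : LeibnizSuperalgebra L'}
  {C : LeibnizSuperalgebra L''}

/-- The composite of two isomorphisms. -/
def Iso.trans (f : Iso A B) (f' : Iso B C) : Iso A C :=
  Iso.ofLE (f.toEquiv.trans f'.toEquiv)
    (fun i x hx => (f'.mem_part_iff i _).2 ((f.mem_part_iff i x).2 hx))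
    (fun x y => by simp [f.map_bracket, f'.map_bracket])

/-- The Leibniz superalgebra structure pulled back along a linear equivalence. -/
def pullback (B : LeibnizSuperalgebra L') (e : L ≃ₗ[ℂ] L') : LeibnizSuperalgebra L where
  part i := (B.part i).comap e.toLinearMap
  isCompl := by
    constructor
    · rw [Submodule.disjoint_def]
      intro x h0 h1
      exact e.map_eq_zero_iff.1 (Submodule.disjoint_def.1 B.isCompl.disjoint _ h0 h1)
    · rw [codisjoint_iff, eq_top_iff]
      intro x _
      obtain ⟨u, hu, v, hv, h⟩ := B.exists_homogeneous (e x)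
      exact Submodule.mem_sup.2 ⟨e.symm u, by simpa using hu, e.symm v, by simpa using hv,
        by rw [← map_add, h, e.symm_apply_apply]⟩
  bracket := (B.bracket.compl₁₂ e.toLinearMap e.toLinearMap).compr₂ e.symm.toLinearMap
  bracket_mem i j x y hx hy := by simpa using B.bracket_mem i j _ _ hx hy
  leibniz i j x y z hy hz := by
    have h := B.leibniz i j (e x) (e y) (e z) hy hz
    simp [h]

/-- The pulled back structure is isomorphic to the original one. -/
def pullbackIso (B : LeibnizSuperalgebra L') (e : L ≃ₗ[ℂ] L') : Iso (B.pullback e) B :=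
  Iso.ofLE e (fun _ _ hx => hx) (fun x y => by simp [pullback])

theorem Iso.map_prod (f : Iso A B) (U W : Submodule ℂ L) :
    (A.prod U W).map f.toEquiv.toLinearMap =
      B.prod (U.map f.toEquiv.toLinearMap) (W.map f.toEquiv.toLinearMap) := by
  apply le_antisymm
  · rw [Submodule.map_le_iff_le_comap]
    refine Submodule.map₂_le.2 fun x hx y hy => ?_
    rw [Submodule.mem_comap, LinearEquiv.coe_coe, f.map_bracket]
    exact Submodule.apply_mem_map₂ _ ⟨x, hx, rfl⟩ ⟨y, hy, rfl⟩
  · refine Submodule.map₂_le.2 ?_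
    rintro _ ⟨x, hx, rfl⟩ _ ⟨y, hy, rfl⟩
    exact ⟨A.bracket x y, Submodule.apply_mem_map₂ _ hx hy, f.map_bracket x y⟩

theorem Iso.map_lowerCentral (f : Iso A B) (U : Submodule ℂ L) (k : ℕ) :
    (A.lowerCentral U k).map f.toEquiv.toLinearMap =
      B.lowerCentral (U.map f.toEquiv.toLinearMap) k := by
  induction k with
  | zero => rfl
  | succ k ih => rw [lowerCentral, f.map_prod, ih, lowerCentral]

theorem Iso.isNilpotent_map (f : Iso A B) {U : Submodule ℂ L} (h : A.IsNilpotent U) :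
    B.IsNilpotent (U.map f.toEquiv.toLinearMap) := by
  obtain ⟨k, hk⟩ := h
  exact ⟨k, by rw [← f.map_lowerCentral, hk, Submodule.map_bot]⟩

theorem Iso.map_square (f : Iso A B) : A.square.map f.toEquiv.toLinearMap = B.square := by
  rw [square, f.map_prod, Submodule.map_top, LinearEquiv.range, square]

theorem Iso.isIdeal_map (f : Iso A B) {I : Submodule ℂ L} (h : A.IsIdeal I) :
    B.IsIdeal (I.map f.toEquiv.toLinearMap) where
  graded := by
    rintro _ ⟨x, hx, rfl⟩
    obtain ⟨u, hu, v, hv, rfl⟩ := Submodule.mem_sup.1 (h.graded hx)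
    exact Submodule.mem_sup.2 ⟨f.toEquiv u, ⟨⟨u, hu.1, rfl⟩, (f.mem_part_iff 0 u).2 hu.2⟩,
      f.toEquiv v, ⟨⟨v, hv.1, rfl⟩, (f.mem_part_iff 1 v).2 hv.2⟩, (map_add f.toEquiv u v).symm⟩
  bracket_left := by
    rintro _ ⟨x, hx, rfl⟩ y
    exact ⟨_, h.bracket_left x hx (f.toEquiv.symm y), by simp [f.map_bracket]⟩
  bracket_right := by
    rintro _ ⟨x, hx, rfl⟩ y
    exact ⟨_, h.bracket_right x hx (f.toEquiv.symm y), by simp [f.map_bracket]⟩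

theorem Iso.isNilradical_map (f : Iso A B) {N : Submodule ℂ L} (h : A.IsNilradical N) :
    B.IsNilradical (N.map f.toEquiv.toLinearMap) where
  isIdeal := f.isIdeal_map h.isIdeal
  isNilpotent := f.isNilpotent_map h.isNilpotent
  le I hI hI' := by
    have hle := h.le _ (f.symm.isIdeal_map hI) (f.symm.isNilpotent_map hI')
    intro x hx
    exact ⟨f.toEquiv.symm x, hle ⟨x, hx, rfl⟩, by simp⟩

theorem Iso.nilradicalIsoTo (f : Iso A B) (h : A.NilradicalIsoTo C) :
    B.NilradicalIsoTo C := by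
  obtain ⟨N, hN, ⟨φ⟩⟩ := h
  refine ⟨_, f.isNilradical_map hN, ⟨Iso.trans (Iso.symm ?_) φ⟩⟩
  exact Iso.ofLE (f.toEquiv.submoduleMap N) (fun i x hx => (f.mem_part_iff i x.1).2 hx)
    (fun x y => Subtype.ext (f.map_bracket x.1 y.1))

theorem derived_succ_le_lowerCentral (A : LeibnizSuperalgebra L) (k : ℕ) :
    A.derived ⊤ (k + 1) ≤ A.lowerCentral A.square k := by
  induction k with
  | zero => exact le_rfl
  | succ k ih =>
    exact Submodule.map₂_le_map₂ ih (ih.trans (lowerCentral_le A.isIdeal_square k))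

theorem isSolvable_of_isNilpotent_square (h : A.IsNilpotent A.square) : A.IsSolvable := by
  obtain ⟨k, hk⟩ := h
  exact ⟨k + 1, le_bot_iff.1 (hk ▸ A.derived_succ_le_lowerCentral k)⟩

theorem lowerCentral_mono (A : LeibnizSuperalgebra L) {U W : Submodule ℂ L} (h : U ≤ W)
    (k : ℕ) : A.lowerCentral U k ≤ A.lowerCentral W k := by
  induction k with
  | zero => exact h
  | succ k ih => exact Submodule.map₂_le_map₂ ih h

/-- A nilpotent ideal contains no element with an eigenvector of nonzero eigenvalue. -/
theorem eq_zero_of_bracket_eq_smul {I : Submodule ℂ L} (hI : A.IsIdeal I)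
    (hI' : A.IsNilpotent I) {s v : L} (hv : v ∈ I) {c : ℂ} (h : A.bracket s v = c • s)
    (hs : s ≠ 0) : c = 0 := by
  by_contra hc
  -- For `c ≠ 0`, `s = c⁻¹ [s, v]` with `v ∈ I`. This puts `s` in `I`, and then in every term of its
  -- central sequence.
  have hsI : s ∈ I := by
    have := I.smul_mem c⁻¹ (hI.bracket_right v hv s)
    rwa [h, smul_smul, inv_mul_cancel₀ hc, one_smul] at this
  obtain ⟨k, hk⟩ := hI'
  have hmem : ∀ k, s ∈ A.lowerCentral I k := by
    intro k
    induction k with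
    | zero => exact hsI
    | succ k ih =>
      have := Submodule.smul_mem _ c⁻¹ (Submodule.apply_mem_map₂ A.bracket ih hv)
      rwa [h, smul_smul, inv_mul_cancel₀ hc, one_smul] at this
  have := hmem k
  rw [hk, Submodule.mem_bot] at this
  exact hs this

end Transport

/-! ### The superalgebra `SLP^{n,m}` satisfies the hypotheses -/

section SLP
variable {n m : ℕ}

theorem supported_single_mem {ι : Type*} {s : Set ι} {S : Submodule ℂ (ι →₀ ℂ)}
    (h : ∀ i ∈ s, Finsupp.single i 1 ∈ S) : Finsupp.supported ℂ ℂ s ≤ S := by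
  rw [Finsupp.supported_eq_span_single, Submodule.span_le]
  rintro _ ⟨i, hi, rfl⟩
  exact h i hi

theorem map₂_tableBracket_le {ι : Type*} {c : ι → ι → (ι →₀ ℂ)} {s t : Set ι}
    {S : Submodule ℂ (ι →₀ ℂ)} (h : ∀ i ∈ s, ∀ j ∈ t, c i j ∈ S) :
    Submodule.map₂ (tableBracket c) (Finsupp.supported ℂ ℂ s) (Finsupp.supported ℂ ℂ t) ≤ S := by
  rw [Finsupp.supported_eq_span_single, Finsupp.supported_eq_span_single,
    Submodule.map₂_span_span, Submodule.span_le]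
  rintro _ ⟨_, ⟨i, hi, rfl⟩, _, ⟨j, hj, rfl⟩, rfl⟩
  simpa [tableBracket_single] using h i hi j hj

/-- The indices of `x` and `y` that are at least `k`. -/
def SLPIndex.tail (n m k : ℕ) : Set (SLPIndex n m)
  | .x i => k ≤ i.val
  | .y j => k ≤ j.val
  | _ => False

theorem SLPIndex.table_mem_tail (i j : SLPIndex n m) :
    SLPIndex.table i j ∈ Finsupp.supported ℂ ℂ (SLPIndex.tail n m 0) := by
  rcases i with i | _ | _ | _ | i <;> rcases j with j | _ | _ | _ | j <;>
    simp only [SLPIndex.table, SLPIndex.nextX, SLPIndex.nextY] <;> (try split_ifs) <;>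
    first
      | exact Submodule.zero_mem _
      | exact Finsupp.single_mem_supported _ _ (Nat.zero_le _)

/-- Within the span of the `x` and `y`, a nonzero product raises the index of its left factor by
one; this bounds the central sequence of `SLPNil`. -/
theorem SLPIndex.table_mem_tail_succ {k : ℕ} {i j : SLPIndex n m}
    (hi : i ∈ SLPIndex.tail n m k) (hj : j ∈ SLPIndex.tail n m 0) :
    SLPIndex.table i j ∈ Finsupp.supported ℂ ℂ (SLPIndex.tail n m (k + 1)) := by
  rcases i with i | _ | _ | _ | i <;> rcases j with j | _ | _ | _ | j <;>
    first
      | exact hi.elim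
      | exact hj.elim
      | skip
  all_goals simp only [SLPIndex.table, SLPIndex.nextX, SLPIndex.nextY]
  all_goals try split_ifs
  all_goals first
      | exact Submodule.zero_mem _
      | exact Finsupp.single_mem_supported _ _ (Nat.succ_le_succ hi)

/-- The nilradical of `SLP^{n,m}`. -/
noncomputable def SLPNil (n m : ℕ) : Submodule ℂ (SLPIndex n m →₀ ℂ) :=
  Finsupp.supported ℂ ℂ (SLPIndex.tail n m 0)

theorem SLP_square_le : (SLP n m).square ≤ SLPNil n m := by
  rw [square, ← Finsupp.supported_univ]
  exact map₂_tableBracket_le fun i _ j _ => SLPIndex.table_mem_tail i j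

theorem SLPNil_isIdeal : (SLP n m).IsIdeal (SLPNil n m) := by
  refine (SLP n m).isIdeal_of_square_le SLP_square_le (supported_single_mem fun i hi => ?_)
  have h : Finsupp.single i (1 : ℂ) ∈ SLPNil n m := Finsupp.single_mem_supported _ _ hi
  rcases (by decide : ∀ s : ZMod 2, s = 0 ∨ s = 1) (SLPIndex.parity i) with hp | hp
  · exact Submodule.mem_sup_left ⟨h, Finsupp.single_mem_supported _ _ hp⟩
  · exact Submodule.mem_sup_right ⟨h, Finsupp.single_mem_supported _ _ hp⟩

theorem SLPNil_isNilpotent : (SLP n m).IsNilpotent (SLPNil n m) := by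
  have h : ∀ k, (SLP n m).lowerCentral (SLPNil n m) k ≤
      Finsupp.supported ℂ ℂ (SLPIndex.tail n m k) := by
    intro k
    induction k with
    | zero => exact le_rfl
    | succ k ih =>
      exact (Submodule.map₂_le_map₂_left ih).trans
        (map₂_tableBracket_le fun i hi j hj => SLPIndex.table_mem_tail_succ hi hj)
  refine ⟨n + m, le_bot_iff.1 ((h (n + m)).trans ?_)⟩
  have : SLPIndex.tail n m (n + m) = ∅ := by
    rw [Set.eq_empty_iff_forall_notMem]
    rintro (i | _ | _ | _ | i) hi
    · exact absurd (show n + m ≤ i.val from hi) (by have := i.2; omega)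
    · exact hi
    · exact hi
    · exact hi
    · exact absurd (show n + m ≤ i.val from hi) (by have := i.2; omega)
  rw [this, Finsupp.supported_empty]

theorem SLPNil_isNilradical (hn : 2 ≤ n) (hm : 1 ≤ m) :
    (SLP n m).IsNilradical (SLPNil n m) := by
  refine ⟨SLPNil_isIdeal, SLPNil_isNilpotent, fun I hI hI' v hv => ?_⟩
  -- Common eigenvectors of all right multiplications test membership in a nilpotent ideal: each
  -- eigenvalue must vanish on it. The vectors `x_1`, `x_n`, `y_m` have eigenvalues `v_{t1}`, `(n-2)
  -- v_{t1} + v_{t2}`, `(m-1) v_{t1} + v_{t3}`, so all three `t`-coordinates of `v` are zero.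
  have eigen : ∀ (i : SLPIndex n m) (c : (SLPIndex n m →₀ ℂ) →ₗ[ℂ] ℂ),
      (∀ j, SLPIndex.table i j = c (Finsupp.single j 1) • Finsupp.single i 1) → c v = 0 := by
    intro i c h
    refine eq_zero_of_bracket_eq_smul hI hI' hv (s := Finsupp.single i 1) ?_ (by simp)
    have : tableBracket SLPIndex.table (Finsupp.single i 1) =
        c.smulRight (Finsupp.single i 1) := by
      ext1 j
      ext1
      simp [tableBracket_single, h]
    exact LinearMap.congr_fun this v
  have h1 : v .t1 = 0 := eigen (.x ⟨0, by omega⟩) (Finsupp.lapply .t1) (by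
    rintro (j | _ | _ | _ | j) <;> simp [SLPIndex.table])
  have h2 : v .t2 = 0 := by
    have h := eigen (.x ⟨n - 1, by omega⟩)
      (((n - 1 : ℕ) - 1 : ℂ) • Finsupp.lapply .t1 + Finsupp.lapply .t2) (by
        have e0 : n - 1 ≠ 0 := by omega
        have e1 : 1 ≤ n - 1 := by omega
        have e2 : n - 1 + 1 = n := by omega
        rintro (j | _ | _ | _ | j) <;> simp [SLPIndex.table, SLPIndex.nextX, e0, e1, e2])
    simpa [h1] using h
  have h3 : v .t3 = 0 := by
    have h := eigen (.y ⟨m - 1, by omega⟩)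
      (((m - 1 : ℕ) : ℂ) • Finsupp.lapply .t1 + Finsupp.lapply .t3) (by
        have e2 : m - 1 + 1 = m := by omega
        rintro (j | _ | _ | _ | j) <;> simp [SLPIndex.table, SLPIndex.nextY, e2])
    simpa [h1] using h
  refine (Finsupp.mem_supported' _ _).2 ?_
  rintro (i | _ | _ | _ | i) hi
  · exact absurd (Nat.zero_le _) hi
  · exact h1
  · exact h2
  · exact h3
  · exact absurd (Nat.zero_le _) hi

theorem SLP_isNilpotent_square : (SLP n m).IsNilpotent (SLP n m).square := by
  obtain ⟨k, hk⟩ := SLPNil_isNilpotent (n := n) (m := m)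
  exact ⟨k, le_bot_iff.1 (hk ▸ (SLP n m).lowerCentral_mono SLP_square_le k)⟩

/-- The inclusion of the basis of `LP^{n,m}` in that of `SLP^{n,m}`. -/
def LPIndex.toSLP : LPIndex n m → SLPIndex n m
  | .x i => .x i
  | .y j => .y j

theorem LPIndex.toSLP_injective : Function.Injective (LPIndex.toSLP (n := n) (m := m)) := by
  rintro (i | i) (j | j) h <;> simp_all [LPIndex.toSLP]

theorem SLP_nilradicalIsoTo (hn : 2 ≤ n) (hm : 1 ≤ m) :
    (SLP n m).NilradicalIsoTo (LP n m) := by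
  refine ⟨_, SLPNil_isNilradical hn hm, ?_⟩
  have hmem : ∀ i : LPIndex n m, i.toSLP ∈ SLPIndex.tail n m 0 := by
    rintro (i | i) <;> exact Nat.zero_le _
  let b : LPIndex n m → SLPNil n m := fun i =>
    ⟨Finsupp.single i.toSLP 1, Finsupp.single_mem_supported _ _ (hmem i)⟩
  have hb : ∀ u, (Finsupp.linearCombination ℂ b u).1 = Finsupp.mapDomain LPIndex.toSLP u := by
    have : (SLPNil n m).subtype ∘ₗ Finsupp.linearCombination ℂ b =
        Finsupp.lmapDomain ℂ ℂ LPIndex.toSLP := by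
      ext1 i
      ext1
      simp [b]
    exact LinearMap.congr_fun this
  have hinj : Function.Injective (Finsupp.linearCombination ℂ b) := fun u v h =>
    Finsupp.mapDomain_injective LPIndex.toSLP_injective (by rw [← hb, ← hb, h])
  have hsurj : Function.Surjective (Finsupp.linearCombination ℂ b) := by
    have h : SLPNil n m ≤ LinearMap.range
        (Finsupp.lmapDomain ℂ ℂ (LPIndex.toSLP (n := n) (m := m))) :=
      supported_single_mem fun i hi => by
        rcases i with i | _ | _ | _ | i
        · exact ⟨Finsupp.single (.x i) 1, by simp [LPIndex.toSLP]⟩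
        · exact hi.elim
        · exact hi.elim
        · exact hi.elim
        · exact ⟨Finsupp.single (.y i) 1, by simp [LPIndex.toSLP]⟩
    rintro ⟨v, hv⟩
    obtain ⟨u, hu⟩ := h hv
    exact ⟨u, Subtype.ext ((hb u).trans hu)⟩
  obtain ⟨Φ⟩ : Nonempty (Iso (LP n m) ((SLP n m).ofIdeal (SLPNil n m) SLPNil_isIdeal)) := by
    refine nonempty_iso_ofTable _ b ⟨hinj, hsurj⟩ ?_ ?_
    · intro i
      change Finsupp.single _ (1 : ℂ) ∈ Finsupp.supported ℂ ℂ {k | SLPIndex.parity k = _}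
      rcases i with i | i <;> exact Finsupp.single_mem_supported _ _ rfl
    · intro i j
      apply Subtype.ext
      rw [hb]
      change tableBracket SLPIndex.table (Finsupp.single i.toSLP 1)
        (Finsupp.single j.toSLP 1) = _
      rw [tableBracket_single, mul_one, one_smul]
      rcases i with i | i <;> rcases j with j | j <;>
        simp only [LPIndex.toSLP, LPIndex.table, SLPIndex.table, LPIndex.nextX, LPIndex.nextY,
          SLPIndex.nextX, SLPIndex.nextY] <;> (try split_ifs) <;>
        simp [Finsupp.mapDomain_single, LPIndex.toSLP]
  exact ⟨Φ.symm⟩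

end SLP

end LeibnizSuperalgebra

/-! ### The classification theorem -/

theorem theorem5p1 (n m : ℕ) (hn : 3 ≤ n) (hm : 2 ≤ m)
    {L : Type u} [AddCommGroup L] [Module ℂ L] [FiniteDimensional ℂ L]
    (A : LeibnizSuperalgebra L)
    (hsolv : A.IsSolvable) (hsq : A.IsNilpotent A.square)
    (hnil : A.NilradicalIsoTo (LeibnizSuperalgebra.LP n m))
    (hmax : ∀ (L' : Type u) [AddCommGroup L'] [Module ℂ L'] [FiniteDimensional ℂ L']
      (A' : LeibnizSuperalgebra L'),
      A'.IsSolvable → A'.IsNilpotent A'.square →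
      A'.NilradicalIsoTo (LeibnizSuperalgebra.LP n m) →
      Module.finrank ℂ L' ≤ Module.finrank ℂ L) :
    Nonempty (LeibnizSuperalgebra.Iso A (LeibnizSuperalgebra.SLP n m)) := by
  obtain ⟨N, hN, ⟨f⟩⟩ := hnil
  refine LeibnizSuperalgebra.nonempty_iso_SLP hn hm hN (hN.square_le hsq) f ?_
  -- Maximality compares `L` only with spaces in its own universe, so `SLP^{n,m}` is lifted there
  -- before it serves as the competitor of dimension `n + m + 3`.
  let e : ULift.{u} (LeibnizSuperalgebra.SLPIndex n m →₀ ℂ) ≃ₗ[ℂ]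
    (LeibnizSuperalgebra.SLPIndex n m →₀ ℂ) := ULift.moduleEquiv
  let g := ((LeibnizSuperalgebra.SLP n m).pullbackIso e).symm
  have hsq' : ((LeibnizSuperalgebra.SLP n m).pullback e).IsNilpotent
      ((LeibnizSuperalgebra.SLP n m).pullback e).square := by
    rw [← g.map_square]
    exact g.isNilpotent_map LeibnizSuperalgebra.SLP_isNilpotent_square
  have h := hmax _ ((LeibnizSuperalgebra.SLP n m).pullback e)
    (LeibnizSuperalgebra.isSolvable_of_isNilpotent_square hsq') hsq'
    (g.nilradicalIsoTo (LeibnizSuperalgebra.SLP_nilradicalIsoTo (by omega) (by omega)))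
  rwa [e.finrank_eq, LeibnizSuperalgebra.SLPIndex.finrank] at h
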